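/- **Setting.** Let $D=D[0,\infty)$ be the space of real-valued càdlàg functions on $[0,\infty)$. A *$D$-valued process* is a family of real random variables $(Z(t))_{t\ge0}$ whose trajectories lie in $D$. For a non-decreasing unbounded $y\in D$ write $y^{-1}(s)=\inf\{t\ge 0: y(t)>s\}$. *Convergence of processes.* $Z_n\to Z$ *f.d.d.* means that, for some dense set $S\subset[0,\infty)$ containing $0$, the vectors $(Z_n(t_1),\dots,Z_n(t_k))$ converge in law to $(Z(t_1),\dots,Z(t_k))$ for all $t_1,\dots,t_k\in S$ (and likewise for pairs of processes). For $a,b,c\in\mathbb R$ let $\mathbb C(a,b,c)=|c-a|$ and let $\mathbb M(a,b,c)$ be the distance from $b$ to the segment with endpoints $a$ and $c$; for $\mathbb H\in\{\mathbb C,\mathbb M\}$ put $$\omega_{\mathbb H}(x,\delta,T)=\sup\{\mathbb H(x(t_1),x(t_2),x(t_3)) : 0\le t_1<t_2<t_3\le T,\ t_3-t_1<\delta\}.$$ $Z_n$ *converges weakly to $Z$ in the $\mathcal C$-topology* (for $\mathbb H=\mathbb C$), respectively *in the $\mathcal M_1$-topology* (for $\mathbb H=\mathbb M$), if $Z_n\to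 Z$ f.d.d., the laws of $(Z_n(t))_n$ are tight for every $t$ in a dense subset of $[0,\infty)$ containing $0$, and $\lim_{\delta\to0}\limsup_{n\to\infty}P\{\omega_{\mathbb H}(Z_n,\delta,T)>\varepsilon\}=0$ for all $\varepsilon,T>0$. *The $\mathcal L^2_w$-topology.* $\mathcal L^2_{loc}$ is the space of Lebesgue measurable $x:[0,\infty)\to\mathbb R$, modulo a.e. equality, with $\int_0^Tx^2(t)\,dt<\infty$ for every $T>0$. The $\mathcal L^2_w$-topology is the coarsest topology on $\mathcal L^2_{loc}$ making all functionals $x\mapsto\int_0^Tx(t)f(t)\,dt$, with $T>0$ and $f\in\mathcal L^2[0,T]$, continuous. $\mathcal L^2_{loc}$-valued random elements $Z_n$ *converge weakly to $Z$ in the $\mathcal L^2_w$-topology* if their laws on the Borel sets of this topology satisfy $E\varphi(Z_n)\to E\varphi(Z)$ for all bounded $\mathcal L^2_w$-continuous $\varphi:\mathcal L^2_{loc}\to\mathbb R$. **Theorem 2.2.** Let $X$, $Y$, $X_n$, $Y_n$ ($n\in\mathbb N$) be $D$-valued processes, with $X,Y$ defined on a common probability space and, for each $n$, $X_n,Y_n$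 defined on a common probability space. Suppose that $X_n$ converges weakly to $X$ in the $\mathcal C$-topology, that $(X_n,Y_n)\to(X,Y)$ f.d.d., and that almost surely $Y$ and each $Y_n$ are non-negative, non-decreasing and tend to $\infty$ as $t\to\infty$. Assume moreover that one of the following holds: a) $Y_n$ converges weakly to $Y$ in the $\mathcal M_1$-topology, and $Y_n^{-1}(0)=0$ almost surely for every $n$; or b) $Y_n^{-1}$ converges weakly to $Y^{-1}$ in the $\mathcal M_1$-topology, and $Y_n(0)=0$ almost surely for every $n$. Then $X_n\circ Y_n$ converges weakly to $X\circ Y$ in the $\mathcal L^2_w$-topology. -/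

import Mathlib

open Set Filter MeasureTheory ProbabilityTheory
open scoped Topology NNReal ENNReal

noncomputable section

namespace CadlagComp

/-! ### Càdlàg paths on `[0, ∞)` -/

/-- A function on `[0, ∞)` is càdlàg: right-continuous with (finite) left limits everywhere.
At `t = 0` the left-limit condition is void, since `𝓝[<] 0 = ⊥` in `ℝ≥0`. -/
def IsCadlag (x : ℝ≥0 → ℝ) : Prop :=
  ∀ t, ContinuousWithinAt x (Ici t) t ∧ ∃ l, Tendsto x (𝓝[<] t) (𝓝 l)

/-- The space `D = D[0, ∞)` of real-valued càdlàg trajectories. -/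
structure CadlagPath where
  /-- the underlying function -/
  toFun : ℝ≥0 → ℝ
  /-- it is càdlàg -/
  cadlag : IsCadlag toFun

instance : CoeFun CadlagPath (fun _ => ℝ≥0 → ℝ) := ⟨CadlagPath.toFun⟩

/-- A right-continuous function on `[0, ∞)` is the pointwise limit of the step functions
`t ↦ x ((⌊n t⌋ + 1) / n)`, hence Borel measurable. -/
theorem IsCadlag.measurable {x : ℝ≥0 → ℝ} (hx : IsCadlag x) : Measurable x := by
  have hf : ∀ n : ℕ, Measurable
      (fun t : ℝ≥0 => x (((⌊((n : ℝ≥0) + 1) * t⌋₊ : ℝ≥0) + 1) / ((n : ℝ≥0) + 1))) := by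
    intro n
    have h1 : Measurable (fun t : ℝ≥0 => ⌊((n : ℝ≥0) + 1) * t⌋₊) :=
      Nat.measurable_floor.comp (measurable_const.mul measurable_id)
    have h2 : Measurable (fun k : ℕ => x (((k : ℝ≥0) + 1) / ((n : ℝ≥0) + 1))) :=
      measurable_from_top
    exact h2.comp h1
  refine measurable_of_tendsto_metrizable hf ?_
  rw [tendsto_pi_nhds]
  intro t
  refine (hx t).1.tendsto.comp ?_
  rw [tendsto_nhdsWithin_iff]
  have hpos : ∀ n : ℕ, (0 : ℝ≥0) < (n : ℝ≥0) + 1 := fun n => by positivity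
  have hlow : ∀ n : ℕ, t ≤ ((⌊((n : ℝ≥0) + 1) * t⌋₊ : ℝ≥0) + 1) / ((n : ℝ≥0) + 1) := by
    intro n
    rw [le_div_iff₀ (hpos n), mul_comm]
    exact (Nat.lt_floor_add_one _).le
  refine ⟨?_, Eventually.of_forall fun n => hlow n⟩
  have hup : ∀ n : ℕ, ((⌊((n : ℝ≥0) + 1) * t⌋₊ : ℝ≥0) + 1) / ((n : ℝ≥0) + 1)
      ≤ t + 1 / ((n : ℝ≥0) + 1) := by
    intro n
    rw [add_div]
    gcongr
    rw [div_le_iff₀ (hpos n), mul_comm t]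
    exact Nat.floor_le (by positivity)
  have hlim : Tendsto (fun n : ℕ => t + 1 / ((n : ℝ≥0) + 1)) atTop (𝓝 t) := by
    simpa using (tendsto_const_nhds (x := t)).add
      (tendsto_one_div_add_atTop_nhds_zero_nat (𝕜 := ℝ≥0))
  exact tendsto_of_tendsto_of_tendsto_of_le_of_le tendsto_const_nhds hlim hlow hup

/-- A càdlàg function is bounded on bounded time sets. -/
theorem IsCadlag.exists_bound {x : ℝ≥0 → ℝ} (hx : IsCadlag x) (T : ℝ≥0) :
    ∃ C : ℝ, ∀ t ∈ Iic T, |x t| ≤ C := by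
  have hK : IsCompact (Iic T) := by
    rw [← Icc_bot]; exact isCompact_Icc
  refine hK.induction_on (p := fun s => ∃ C : ℝ, ∀ t ∈ s, |x t| ≤ C) ⟨0, by simp⟩ ?_ ?_ ?_
  · rintro s s' hss ⟨C, hC⟩
    exact ⟨C, fun t ht => hC t (hss ht)⟩
  · rintro s s' ⟨C, hC⟩ ⟨C', hC'⟩
    refine ⟨max C C', ?_⟩
    rintro t (ht | ht)
    · exact (hC t ht).trans (le_max_left _ _)
    · exact (hC' t ht).trans (le_max_right _ _)
  · intro t _
    obtain ⟨hr, l, hl⟩ := hx t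
    have h1 : ∀ᶠ s in 𝓝[≥] t, |x s| ≤ |x t| + 1 :=
      (hr.tendsto.abs.eventually (gt_mem_nhds (lt_add_one _))).mono fun s hs => le_of_lt hs
    have h2 : ∀ᶠ s in 𝓝[<] t, |x s| ≤ |l| + 1 :=
      (hl.abs.eventually (gt_mem_nhds (lt_add_one _))).mono fun s hs => le_of_lt hs
    have h3 : ∀ᶠ s in 𝓝 t, |x s| ≤ max (|x t| + 1) (|l| + 1) := by
      rw [← nhdsLT_sup_nhdsGE t, eventually_sup]
      exact ⟨h2.mono fun s hs => hs.trans (le_max_right _ _),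
        h1.mono fun s hs => hs.trans (le_max_left _ _)⟩
    exact ⟨_, mem_nhdsWithin_of_mem_nhds h3, max (|x t| + 1) (|l| + 1), fun s hs => hs⟩

/-! ### Locally square integrable functions and the weak topology -/

/-- Lebesgue measure on `[0, ∞)`. -/
def lebesgue : Measure ℝ≥0 := Measure.comap ((↑) : ℝ≥0 → ℝ) volume

theorem lebesgue_Iic (T : ℝ≥0) : lebesgue (Iic T) = T := by
  have he : MeasurableEmbedding ((↑) : ℝ≥0 → ℝ) :=
    MeasurableEmbedding.subtype_coe measurableSet_Ici
  have him : ((↑) : ℝ≥0 → ℝ) '' Iic T = Icc (0 : ℝ) T := by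
    ext s
    constructor
    · rintro ⟨t, ht, rfl⟩
      exact ⟨t.2, NNReal.coe_le_coe.2 ht⟩
    · rintro ⟨h0, h1⟩
      exact ⟨⟨s, h0⟩, NNReal.coe_le_coe.1 h1, rfl⟩
  rw [lebesgue, he.comap_apply, him, Real.volume_Icc]
  simp

instance (T : ℝ≥0) : IsFiniteMeasure (lebesgue.restrict (Iic T)) :=
  ⟨by simp [lebesgue_Iic]⟩

/-- `𝓛²_loc`: (classes modulo a.e. equality of) Lebesgue measurable functions on `[0, ∞)` whose
restriction to `[0, T]` is square integrable for every `T`. -/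
def L2loc : Type :=
  {x : ℝ≥0 →ₘ[lebesgue] ℝ // ∀ T : ℝ≥0, MemLp x 2 (lebesgue.restrict (Iic T))}

/-- The class in `𝓛²_loc` of a measurable locally square integrable function. -/
def L2loc.mk (x : ℝ≥0 → ℝ) (hm : Measurable x)
    (hx : ∀ T : ℝ≥0, MemLp x 2 (lebesgue.restrict (Iic T))) : L2loc :=
  ⟨AEEqFun.mk x hm.aestronglyMeasurable, fun T =>
    (memLp_congr_ae (ae_restrict_of_ae (AEEqFun.coeFn_mk x hm.aestronglyMeasurable))).2 (hx T)⟩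

/-- The scalar product `∫₀ᵀ x(t) f(t) dt`. -/
def L2loc.pairing (x : L2loc) (T : ℝ≥0) (f : ℝ≥0 → ℝ) : ℝ :=
  ∫ t in Iic T, x.1 t * f t ∂lebesgue

/-- The `𝓛²_w`-topology on `𝓛²_loc`: the coarsest topology for which all the functionals
`x ↦ ∫₀ᵀ x(t) f(t) dt`, with `T > 0` and `f ∈ 𝓛²[0, T]`, are continuous. -/
instance : TopologicalSpace L2loc :=
  ⨅ (T : ℝ≥0) (_ : 0 < T) (f : ℝ≥0 → ℝ) (_ : MemLp f 2 (lebesgue.restrict (Iic T))),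
    TopologicalSpace.induced (fun x : L2loc => x.pairing T f) inferInstance

/-- Convergence in the `𝓛²_w`-topology is convergence of all the scalar products. -/
theorem L2loc.tendsto_iff {ι : Type*} {l : Filter ι} {u : ι → L2loc} {x : L2loc} :
    Tendsto u l (𝓝 x) ↔ ∀ T : ℝ≥0, 0 < T → ∀ f : ℝ≥0 → ℝ,
      MemLp f 2 (lebesgue.restrict (Iic T)) →
        Tendsto (fun i => (u i).pairing T f) l (𝓝 (x.pairing T f)) := by
  simp only [nhds_iInf, nhds_induced, tendsto_iInf, tendsto_comap_iff,
    Function.comp_def]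

/-- `𝓛²_loc` carries the Borel σ-algebra of the `𝓛²_w`-topology. -/
instance : MeasurableSpace L2loc := borel L2loc

instance : BorelSpace L2loc := ⟨rfl⟩

/-! ### Composition and inverse of paths -/

/-- The composition `x ∘ y`. Only paths `y` with values in `[0, ∞)` are meant; the negative part
of `y` is truncated so that the function is defined for every `y`. -/
def compFun (x y : CadlagPath) : ℝ≥0 → ℝ := fun t => x (y t).toNNReal

theorem compFun_measurable (x y : CadlagPath) : Measurable (compFun x y) :=
  x.cadlag.measurable.comp y.cadlag.measurable.real_toNNReal

theorem compFun_memLp (x y : CadlagPath) (T : ℝ≥0) :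
    MemLp (compFun x y) 2 (lebesgue.restrict (Iic T)) := by
  obtain ⟨C, hC⟩ := y.cadlag.exists_bound T
  obtain ⟨C', hC'⟩ := x.cadlag.exists_bound C.toNNReal
  refine MemLp.of_bound (compFun_measurable x y).aestronglyMeasurable C' ?_
  refine (ae_restrict_iff' measurableSet_Iic).2 (Eventually.of_forall fun t ht => ?_)
  exact hC' _ (Real.toNNReal_le_toNNReal ((le_abs_self _).trans (hC t ht)))

/-- The composition `x ∘ y` as an element of `𝓛²_loc`. -/
def comp (x y : CadlagPath) : L2loc :=
  L2loc.mk (compFun x y) (compFun_measurable x y) (compFun_memLp x y)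

/-- The inverse `y⁻¹(s) = inf {t ≥ 0 : y(t) > s}` of a non-decreasing unbounded path. -/
def inverse (y : CadlagPath) : ℝ≥0 → ℝ≥0 := fun s => sInf {t : ℝ≥0 | (s : ℝ) < y t}

/-- Membership in `D_↑`: non-negative, non-decreasing, and tending to infinity. -/
def IsUnboundedIncreasing (y : CadlagPath) : Prop :=
  (∀ t, 0 ≤ y t) ∧ Monotone y.toFun ∧ Tendsto y.toFun atTop atTop

/-! ### Moduli of continuity -/

/-- `ℂ(a, b, c) = |c - a|`. -/
def gapC (a _b c : ℝ) : ℝ := |c - a|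

/-- `𝕄(a, b, c)`: the distance from `b` to the segment `[a, c]`. -/
def gapM (a b c : ℝ) : ℝ := Metric.infDist b (segment ℝ a c)

/-- The modulus `ω_H(x, δ, T)`, the supremum of `H(x(t₁), x(t₂), x(t₃))` over
`0 ≤ t₁ < t₂ < t₃ ≤ T` with `t₃ - t₁ < δ`. -/
def modulus (H : ℝ → ℝ → ℝ → ℝ) (x : ℝ≥0 → ℝ) (δ : ℝ) (T : ℝ≥0) : ℝ≥0∞ :=
  ⨆ (t₁ : ℝ≥0) (t₂ : ℝ≥0) (t₃ : ℝ≥0) (_ : t₁ < t₂) (_ : t₂ < t₃) (_ : t₃ ≤ T)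
    (_ : (t₃ : ℝ) - t₁ < δ), ENNReal.ofReal (H (x t₁) (x t₂) (x t₃))

/-! ### Weak convergence of processes -/

section Convergence

variable {Ω : ℕ → Type*} {Ω' : Type*} [∀ n, MeasurableSpace (Ω n)] [MeasurableSpace Ω']

/-- Convergence of finite-dimensional distributions, over a dense set of times containing `0`. -/
def TendstoFDD {E : Type*} [TopologicalSpace E] [SecondCountableTopology E] [MeasurableSpace E]
    [OpensMeasurableSpace E] (Z : (n : ℕ) → Ω n → ℝ≥0 → E) (Z' : Ω' → ℝ≥0 → E)
    (μ : (n : ℕ) → Measure (Ω n)) [∀ n, IsProbabilityMeasure (μ n)]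
    (μ' : Measure Ω') [IsProbabilityMeasure μ'] : Prop :=
  ∃ S : Set ℝ≥0, Dense S ∧ 0 ∈ S ∧ ∀ I : Finset ℝ≥0, (I : Set ℝ≥0) ⊆ S →
    TendstoInDistribution (fun n ω (t : I) => Z n ω t) atTop (fun ω (t : I) => Z' ω t) μ μ'

/-- Tightness of a sequence of processes for the topology on `D` attached to `H`: the marginals are
tight over a dense set of times containing `0`, and the modulus `ω_H` is asymptotically small in
probability. -/
def IsTightSeq (H : ℝ → ℝ → ℝ → ℝ) (Z : (n : ℕ) → Ω n → ℝ≥0 → ℝ)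
    (μ : (n : ℕ) → Measure (Ω n)) : Prop :=
  (∃ S : Set ℝ≥0, Dense S ∧ 0 ∈ S ∧ ∀ t ∈ S,
    IsTightMeasureSet (range fun n => (μ n).map (fun ω => Z n ω t))) ∧
  ∀ ε : ℝ≥0∞, 0 < ε → ∀ T : ℝ≥0, 0 < T →
    Tendsto (fun δ : ℝ => limsup (fun n => μ n {ω | ε < modulus H (Z n ω) δ T}) atTop)
      (𝓝[>] 0) (𝓝 0)

/-- Weak convergence of processes for the topology on `D` attached to `H`: tightness and convergence
of finite-dimensional distributions. -/
def TendstoPath (H : ℝ → ℝ → ℝ → ℝ) (Z : (n : ℕ) → Ω n → ℝ≥0 → ℝ) (Z' : Ω' → ℝ≥0 → ℝ)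
    (μ : (n : ℕ) → Measure (Ω n)) [∀ n, IsProbabilityMeasure (μ n)]
    (μ' : Measure Ω') [IsProbabilityMeasure μ'] : Prop :=
  IsTightSeq H Z μ ∧ TendstoFDD Z Z' μ μ'

/-- Weak convergence in the `𝒞`-topology (uniform convergence on compact time sets). -/
def TendstoC (Z : (n : ℕ) → Ω n → ℝ≥0 → ℝ) (Z' : Ω' → ℝ≥0 → ℝ)
    (μ : (n : ℕ) → Measure (Ω n)) [∀ n, IsProbabilityMeasure (μ n)]
    (μ' : Measure Ω') [IsProbabilityMeasure μ'] : Prop :=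
  TendstoPath gapC Z Z' μ μ'

/-- Weak convergence in Skorohod's `ℳ₁`-topology. -/
def TendstoM1 (Z : (n : ℕ) → Ω n → ℝ≥0 → ℝ) (Z' : Ω' → ℝ≥0 → ℝ)
    (μ : (n : ℕ) → Measure (Ω n)) [∀ n, IsProbabilityMeasure (μ n)]
    (μ' : Measure Ω') [IsProbabilityMeasure μ'] : Prop :=
  TendstoPath gapM Z Z' μ μ'

/-- Weak convergence of `𝓛²_loc`-valued processes in the `𝓛²_w`-topology: weak convergence of their
laws as Borel probability measures, tested against all bounded `𝓛²_w`-continuous functions. -/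
def TendstoL2w (Z : (n : ℕ) → Ω n → L2loc) (Z' : Ω' → L2loc)
    (μ : (n : ℕ) → Measure (Ω n)) [∀ n, IsProbabilityMeasure (μ n)]
    (μ' : Measure Ω') [IsProbabilityMeasure μ'] : Prop :=
  TendstoInDistribution Z atTop Z' μ μ'

end Convergence

end CadlagComp

end

namespace CadlagComp

/-! The topology `𝓛²_w` sees paths only through time integrals, so it is enough to control `Xₙ ∘ Yₙ`
at almost every time and to bound it in probability on bounded time intervals.

Control at a fixed time. The function `t ↦ E clip_M (Y t)` is monotone, hence continuous off a
countable set. At such a time `t` there are `s ≤ t ≤ s'` in the dense set `S` between which `Y` has,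
in mean, a small clipped increment. Convergence of the f.d.d. carries this over to `Yₙ`, and
monotonicity puts `Yₙ t` close to `Yₙ s`. Since `Xₙ` is asymptotically equicontinuous, `Xₙ (Yₙ t)`
is then close to a continuous function (`interp`) of `Yₙ s` and of finitely many values of `Xₙ`,
whose law converges. This is `tendsto_integral_prod_compFun`; the bound in probability is
`exists_forall_measure_compFun_gt_le`.

From fixed times to `𝓛²_w`. With large probability the paths stay below suitable levels on all
intervals `[0, k + 1)`. Saturating at these levels and multiplying by `e^{-t}` sends every path into
one closed ball of the dual of `L²`, which is weak-* compact, and the inverse map `expandDual` is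
continuous into `𝓛²_w`. A bounded continuous test function thus becomes a continuous function on a
compact space, and Stone–Weierstrass approximates it by polynomials in evaluations. By Fubini the
expectation of a monomial is an integral over times of product moments, to which dominated
convergence applies. -/

/-! ### Lebesgue measure on the half-line; Borel sets of `𝓛²_loc` -/

theorem measurableEmbedding_coe_nnreal : MeasurableEmbedding ((↑) : ℝ≥0 → ℝ) :=
  MeasurableEmbedding.subtype_coe measurableSet_Ici

theorem map_coe_lebesgue : lebesgue.map ((↑) : ℝ≥0 → ℝ) = volume.restrict (Ici 0) := by
  rw [lebesgue, measurableEmbedding_coe_nnreal.map_comap]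
  congr 1
  ext x
  exact ⟨fun ⟨y, hy⟩ => hy ▸ y.2, fun h => ⟨⟨x, h⟩, rfl⟩⟩

instance : SigmaFinite lebesgue := by
  refine ⟨⟨⟨fun n : ℕ => Iic (n : ℝ≥0), fun _ => trivial, fun n => ?_, ?_⟩⟩⟩
  · simp [lebesgue_Iic]
  · refine eq_univ_of_forall fun t => ?_
    obtain ⟨n, hn⟩ := exists_nat_ge t
    exact mem_iUnion.2 ⟨n, hn⟩

instance : NullSingletonClass lebesgue := by
  refine ⟨fun t => ?_⟩
  rw [lebesgue, measurableEmbedding_coe_nnreal.comap_apply]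
  simp

theorem memLp_exp_neg : MemLp (fun t : ℝ≥0 => Real.exp (-t)) 2 lebesgue := by
  have hm : Measurable (fun t : ℝ≥0 => Real.exp (-t)) := by fun_prop
  rw [memLp_two_iff_integrable_sq hm.aestronglyMeasurable]
  have h := (integrableOn_Ici_iff_integrableOn_Ioi (μ := volume)).2
    (exp_neg_integrableOn_Ioi 0 (b := 2) (by norm_num))
  rw [IntegrableOn, ← map_coe_lebesgue, measurableEmbedding_coe_nnreal.integrable_map_iff] at h
  refine h.congr (Eventually.of_forall fun t => ?_)
  simp only [Function.comp_apply]
  rw [← Real.exp_nat_mul]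
  congr 1
  push_cast
  ring

/-- The restriction of a locally square integrable function to `[0, k]`. -/
noncomputable def L2loc.restr (k : ℕ) (x : L2loc) : Lp ℝ 2 (lebesgue.restrict (Iic (k : ℝ≥0))) :=
  (x.2 k).toLp x.1

/-- The Fréchet topology of `𝓛²_loc`. -/
noncomputable abbrev L2loc.strongTopology : TopologicalSpace L2loc :=
  TopologicalSpace.induced (fun x k => L2loc.restr k x) inferInstance

/-- The topology is induced from a countable product of separable `L²` spaces. Second countability
will turn arbitrary unions of weakly open sets into countable ones. -/
theorem L2loc.secondCountable_strong :
    @SecondCountableTopology L2loc L2loc.strongTopology := by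
  have : Fact ((2 : ℝ≥0∞) ≠ ∞) := ⟨by simp⟩
  exact TopologicalSpace.secondCountableTopology_induced _ _ _

/-- For an integer `k ≥ T` the pairing is an inner product in `L²[0, k]` with `f` extended by zero.
-/
theorem L2loc.continuous_pairing_strong {T : ℝ≥0} {f : ℝ≥0 → ℝ}
    (hf : MemLp f 2 (lebesgue.restrict (Iic T))) :
    @Continuous _ _ L2loc.strongTopology _ (fun x : L2loc => x.pairing T f) := by
  obtain ⟨k, hk⟩ := exists_nat_ge T
  have hle : Iic T ⊆ Iic (k : ℝ≥0) := Iic_subset_Iic.2 hk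
  have hF : MemLp ((Iic T).indicator f) 2 (lebesgue.restrict (Iic (k : ℝ≥0))) := by
    rw [memLp_indicator_iff_restrict measurableSet_Iic, Measure.restrict_restrict measurableSet_Iic,
      inter_eq_self_of_subset_left hle]
    exact hf
  let _ := L2loc.strongTopology
  have h1 : Continuous fun x : L2loc => L2loc.restr k x :=
    continuous_pi_iff.1 (continuous_induced_dom (f := fun (x : L2loc) (k : ℕ) => L2loc.restr k x)) k
  have h2 : Continuous fun x : L2loc => inner ℝ (hF.toLp _) (L2loc.restr k x) :=
    continuous_const.inner h1
  refine h2.congr fun x => ?_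
  have hr : lebesgue.restrict (Iic T) = (lebesgue.restrict (Iic (k : ℝ≥0))).restrict (Iic T) := by
    rw [Measure.restrict_restrict measurableSet_Iic, inter_eq_self_of_subset_left hle]
  rw [L2.inner_def, L2loc.pairing, hr,
    ← integral_indicator (s := Iic T) measurableSet_Iic]
  apply integral_congr_ae
  filter_upwards [hF.coeFn_toLp, (x.2 k).coeFn_toLp] with t h1 h2
  rw [L2loc.restr, h1, h2]
  by_cases h : t ∈ Iic T <;> simp [h]

/-- The topology of `𝓛²_w` is generated by the functionals attached to `𝓛²[0, T]`. -/
theorem L2loc.topology_eq :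
    (inferInstance : TopologicalSpace L2loc) = TopologicalSpace.generateFrom
      {s | ∃ T : ℝ≥0, ∃ f : ℝ≥0 → ℝ, 0 < T ∧ MemLp f 2 (lebesgue.restrict (Iic T)) ∧
        ∃ u : Set ℝ, IsOpen u ∧ s = (fun x : L2loc => x.pairing T f) ⁻¹' u} := by
  apply le_antisymm
  · refine le_generateFrom ?_
    rintro s ⟨T, f, hT, hf, u, hu, rfl⟩
    have h : Continuous (fun x : L2loc => x.pairing T f) := by
      rw [continuous_iff_continuousAt]
      exact fun x => L2loc.tendsto_iff.1 tendsto_id T hT f hf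
    exact hu.preimage h
  · refine le_iInf fun T => le_iInf fun hT => le_iInf fun f => le_iInf fun hf => ?_
    rintro s ⟨u, hu, rfl⟩
    exact TopologicalSpace.isOpen_generateFrom_of_mem ⟨T, f, hT, hf, u, hu, rfl⟩

/-- A random element of `𝓛²_loc` is Borel measurable for the weak topology as soon as its scalar
products are random variables. -/
theorem L2loc.measurable_of_pairing {Ω : Type*} [MeasurableSpace Ω] {Z : Ω → L2loc}
    (h : ∀ T : ℝ≥0, ∀ f : ℝ≥0 → ℝ, MemLp f 2 (lebesgue.restrict (Iic T)) →
      Measurable fun ω => (Z ω).pairing T f) : Measurable Z := by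
  refine measurable_of_isOpen fun U hU => ?_
  have hb := TopologicalSpace.isTopologicalBasis_of_subbasis L2loc.topology_eq
  set B := ((fun f => ⋂₀ f) '' {f | f.Finite ∧ f ⊆ {s | ∃ T : ℝ≥0, ∃ f : ℝ≥0 → ℝ, 0 < T ∧
        MemLp f 2 (lebesgue.restrict (Iic T)) ∧
        ∃ u : Set ℝ, IsOpen u ∧ s = (fun x : L2loc => x.pairing T f) ⁻¹' u}}) with hB
  have hBmeas : ∀ s ∈ B, MeasurableSet (Z ⁻¹' s) ∧ IsOpen[L2loc.strongTopology] s := by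
    rintro s ⟨F, ⟨hF, hFs⟩, rfl⟩
    change MeasurableSet (Z ⁻¹' ⋂₀ F) ∧ IsOpen[L2loc.strongTopology] (⋂₀ F)
    constructor
    · rw [sInter_eq_biInter, preimage_iInter₂]
      refine MeasurableSet.biInter hF.countable fun i hi => ?_
      obtain ⟨T, f, -, hf, u, hu, rfl⟩ := hFs hi
      exact h T f hf hu.measurableSet
    · refine @Set.Finite.isOpen_sInter L2loc L2loc.strongTopology _ hF fun i hi => ?_
      obtain ⟨T, f, -, hf, u, hu, rfl⟩ := hFs hi
      exact @IsOpen.preimage _ _ L2loc.strongTopology _ _ (L2loc.continuous_pairing_strong hf) u hu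
  obtain ⟨S, hSB, rfl⟩ := hb.open_eq_sUnion hU
  -- The weak basic sets are also strongly open, so a countable subfamily already has the same
  -- union.
  obtain ⟨C, hC, hCS, hCU⟩ := @TopologicalSpace.isOpen_sUnion_countable L2loc
    L2loc.strongTopology L2loc.secondCountable_strong S (fun s hs => (hBmeas s (hSB hs)).2)
  rw [← hCU, sUnion_eq_biUnion, preimage_iUnion₂]
  exact MeasurableSet.biUnion hC fun s hs => (hBmeas s (hSB (hCS hs))).1

/-! ### Joint measurability; compositions as random elements -/

/-- A right-continuous process is jointly measurable. -/
theorem measurable_uncurry_of_cadlag {Ω : Type*} [MeasurableSpace Ω] {X : Ω → ℝ≥0 → ℝ}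
    (hc : ∀ ω, IsCadlag (X ω)) (hX : ∀ t, Measurable fun ω => X ω t) :
    Measurable fun p : Ω × ℝ≥0 => X p.1 p.2 := by
  -- Time is rounded up to a grid: only countably many times occur, and the limit is taken from the
  -- right.
  have hf : ∀ n : ℕ, Measurable (fun p : Ω × ℝ≥0 =>
      X p.1 (((⌊((n : ℝ≥0) + 1) * p.2⌋₊ : ℝ≥0) + 1) / ((n : ℝ≥0) + 1))) := by
    intro n
    have h1 : Measurable (fun p : Ω × ℝ≥0 => ((p.1, ⌊((n : ℝ≥0) + 1) * p.2⌋₊) : Ω × ℕ)) :=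
      measurable_fst.prodMk (Nat.measurable_floor.comp (measurable_const.mul measurable_snd))
    have h2 : Measurable (fun q : Ω × ℕ => X q.1 (((q.2 : ℝ≥0) + 1) / ((n : ℝ≥0) + 1))) :=
      measurable_from_prod_countable_left fun k => hX (((k : ℝ≥0) + 1) / ((n : ℝ≥0) + 1))
    exact h2.comp h1
  refine measurable_of_tendsto_metrizable hf ?_
  rw [tendsto_pi_nhds]
  rintro ⟨ω, t⟩
  refine (hc ω t).1.tendsto.comp ?_
  rw [tendsto_nhdsWithin_iff]
  have hpos : ∀ n : ℕ, (0 : ℝ≥0) < (n : ℝ≥0) + 1 := fun n => by positivity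
  have hlow : ∀ n : ℕ, t ≤ ((⌊((n : ℝ≥0) + 1) * t⌋₊ : ℝ≥0) + 1) / ((n : ℝ≥0) + 1) := by
    intro n
    rw [le_div_iff₀ (hpos n), mul_comm]
    exact (Nat.lt_floor_add_one _).le
  refine ⟨?_, Eventually.of_forall fun n => hlow n⟩
  have hup : ∀ n : ℕ, ((⌊((n : ℝ≥0) + 1) * t⌋₊ : ℝ≥0) + 1) / ((n : ℝ≥0) + 1)
      ≤ t + 1 / ((n : ℝ≥0) + 1) := by
    intro n
    rw [add_div]
    gcongr
    rw [div_le_iff₀ (hpos n), mul_comm t]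
    exact Nat.floor_le (by positivity)
  have hlim : Tendsto (fun n : ℕ => t + 1 / ((n : ℝ≥0) + 1)) atTop (𝓝 t) := by
    simpa using (tendsto_const_nhds (x := t)).add
      (tendsto_one_div_add_atTop_nhds_zero_nat (𝕜 := ℝ≥0))
  exact tendsto_of_tendsto_of_tendsto_of_le_of_le tendsto_const_nhds hlim hlow hup

theorem measurable_uncurry_compFun {Ω : Type*} [MeasurableSpace Ω] {X Y : Ω → CadlagPath}
    (hX : ∀ t, Measurable fun ω => X ω t) (hY : ∀ t, Measurable fun ω => Y ω t) :
    Measurable fun p : Ω × ℝ≥0 => compFun (X p.1) (Y p.1) p.2 := by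
  have h1 := measurable_uncurry_of_cadlag (fun ω => (X ω).cadlag) hX
  have h2 := measurable_uncurry_of_cadlag (fun ω => (Y ω).cadlag) hY
  exact h1.comp (measurable_fst.prodMk h2.real_toNNReal)

theorem L2loc.mk_pairing (x : ℝ≥0 → ℝ) (hm : Measurable x)
    (hx : ∀ T : ℝ≥0, MemLp x 2 (lebesgue.restrict (Iic T))) (T : ℝ≥0) (f : ℝ≥0 → ℝ) :
    (L2loc.mk x hm hx).pairing T f = ∫ t in Iic T, x t * f t ∂lebesgue := by
  refine integral_congr_ae ?_
  filter_upwards [ae_restrict_of_ae (AEEqFun.coeFn_mk x hm.aestronglyMeasurable)] with t ht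
  rw [← ht]
  rfl

/-- A jointly measurable process with locally square integrable paths is a random element
of `𝓛²_loc`. -/
theorem L2loc.measurable_mk {Ω : Type*} [MeasurableSpace Ω] {z : Ω → ℝ≥0 → ℝ}
    (hz : Measurable fun p : Ω × ℝ≥0 => z p.1 p.2) (hm : ∀ ω, Measurable (z ω))
    (hx : ∀ ω, ∀ T : ℝ≥0, MemLp (z ω) 2 (lebesgue.restrict (Iic T))) :
    Measurable fun ω => L2loc.mk (z ω) (hm ω) (hx ω) := by
  refine L2loc.measurable_of_pairing fun T f hf => ?_
  simp only [L2loc.mk_pairing]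
  -- Joint measurability of the integrand needs a genuinely measurable version of `f`.
  obtain ⟨g, hg, hfg⟩ := hf.1
  have h : ∀ ω, ∫ t in Iic T, z ω t * f t ∂lebesgue = ∫ t in Iic T, z ω t * g t ∂lebesgue :=
    fun ω => integral_congr_ae (hfg.mono fun t ht => by simp only [ht])
  simp only [h]
  have h2 : StronglyMeasurable (fun p : Ω × ℝ≥0 => z p.1 p.2 * g p.2) :=
    (hz.mul (hg.measurable.comp measurable_snd)).stronglyMeasurable
  exact h2.integral_prod_right.measurable

theorem measurable_comp {Ω : Type*} [MeasurableSpace Ω] {X Y : Ω → CadlagPath}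
    (hX : ∀ t, Measurable fun ω => X ω t) (hY : ∀ t, Measurable fun ω => Y ω t) :
    Measurable fun ω => comp (X ω) (Y ω) :=
  L2loc.measurable_mk (measurable_uncurry_compFun hX hY) _ _

/-! ### Oscillation of paths -/

/-- `gapC` ignores its middle argument, so any time strictly between `s` and `t` completes the
triple. -/
theorem abs_sub_le_of_modulus_le {x : ℝ≥0 → ℝ} {δ η : ℝ} {T : ℝ≥0} (hη : 0 ≤ η)
    (h : modulus gapC x δ T ≤ ENNReal.ofReal η) {s t : ℝ≥0} (hs : s ≤ T) (ht : t ≤ T)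
    (hst : |(s : ℝ) - t| < δ) : |x s - x t| ≤ η := by
  wlog hlt : s < t generalizing s t
  · rcases eq_or_lt_of_le (not_lt.1 hlt) with h' | h'
    · simp [h', hη]
    · rw [abs_sub_comm]
      exact this ht hs (by rwa [abs_sub_comm]) h'
  obtain ⟨u, hsu, hut⟩ := exists_between hlt
  have hd : (t : ℝ) - s < δ := (le_abs_self _).trans_lt (by rwa [abs_sub_comm])
  have h1 : ENNReal.ofReal (gapC (x s) (x u) (x t)) ≤ modulus gapC x δ T :=
    le_iSup_of_le s <| le_iSup_of_le u <| le_iSup_of_le t <| le_iSup_of_le hsu <|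
      le_iSup_of_le hut <| le_iSup_of_le ht <| le_iSup_of_le hd le_rfl
  have h2 := (ENNReal.ofReal_le_ofReal_iff hη).1 (h1.trans h)
  rwa [abs_sub_comm]

/-- A modulus of continuity over short time spans bounds the oscillation over long ones. -/
theorem abs_sub_zero_le_of_osc {x : ℝ≥0 → ℝ} {δ η : ℝ} {T : ℝ≥0} (hδ : 0 < δ)
    (h : ∀ s t : ℝ≥0, s < T → t < T → |(s : ℝ) - t| < δ → |x s - x t| ≤ η) (j : ℕ) :
    ∀ s : ℝ≥0, s < T → (s : ℝ) ≤ j * (δ / 2) → |x s - x 0| ≤ j * η := by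
  induction j with
  | zero =>
    intro s _ hs
    have : s = 0 := by
      rw [← NNReal.coe_eq_zero]
      exact le_antisymm (by simpa using hs) s.2
    simp [this]
  | succ j ih =>
    intro s hsT hs
    push_cast at hs ⊢
    -- One step back, truncated at `0`. Its length is `δ / 2` because the hypothesis requires a
    -- distance strictly below `δ`.
    let u : ℝ≥0 := s - Real.toNNReal (δ / 2)
    have hu : u ≤ s := tsub_le_self
    have hu1 : (u : ℝ) = max (s - δ / 2) 0 := by
      rw [NNReal.coe_sub_def, Real.coe_toNNReal _ (by positivity)]
    have h1 := ih u (hu.trans_lt hsT) (by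
      rw [hu1]
      exact max_le (by linarith) (by positivity))
    have h2 := h s u hsT (hu.trans_lt hsT) (by
      rw [abs_of_nonneg (sub_nonneg.2 (NNReal.coe_le_coe.2 hu)), hu1]
      have := le_max_left ((s : ℝ) - δ / 2) 0
      linarith)
    have h3 := abs_sub_le (x s) (x u) (x 0)
    linarith

/-! ### Interpolation from values on a grid -/

/-- Hat functions around the points of a grid. -/
noncomputable def hat (η y : ℝ) (s : ℝ≥0) : ℝ := max 0 (η - |y - s|)

theorem hat_nonneg (η y : ℝ) (s : ℝ≥0) : 0 ≤ hat η y s := le_max_left _ _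

theorem abs_sub_lt_of_hat_ne_zero {η y : ℝ} {s : ℝ≥0} (h : hat η y s ≠ 0) : |y - s| < η := by
  by_contra h'
  exact h (max_eq_left (by linarith))

/-- Reconstruction at the place `y`, clipped to `[0, M]`, of a path from its values `v` on a
grid `I`. -/
noncomputable def interp (I : Finset ℝ≥0) (η M : ℝ) (v : ℝ≥0 → ℝ) (y : ℝ) : ℝ :=
  (∑ s ∈ I, hat η (max 0 (min y M)) s * v s) / ∑ s ∈ I, hat η (max 0 (min y M)) s

/-- `I` is an `η`-net of `[0, M]`. -/
def IsGrid (I : Finset ℝ≥0) (η M : ℝ) : Prop :=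
  ∀ y : ℝ, 0 ≤ y → y ≤ M → ∃ s ∈ I, |y - (s : ℝ)| < η

/-- The clipped point lies in `[0, M]`, hence within `η` of a grid point. Thanks to clipping this
covers every real `y`, so `interp` is continuous everywhere. -/
theorem IsGrid.sum_hat_pos {I : Finset ℝ≥0} {η M : ℝ} (hI : IsGrid I η M) (hM : 0 ≤ M) (y : ℝ) :
    0 < ∑ s ∈ I, hat η (max 0 (min y M)) s := by
  obtain ⟨s, hs, h⟩ := hI (max 0 (min y M)) (le_max_left _ _) (max_le hM (min_le_right _ _))
  exact Finset.sum_pos' (fun s _ => hat_nonneg _ _ _) ⟨s, hs, lt_max_of_lt_right (by linarith)⟩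

theorem IsGrid.continuous_interp {I : Finset ℝ≥0} {η M : ℝ} (hI : IsGrid I η M) (hM : 0 ≤ M)
    {A : Type*} [TopologicalSpace A] {v : A → ℝ≥0 → ℝ} {y : A → ℝ}
    (hv : ∀ s ∈ I, Continuous fun a => v a s) (hy : Continuous y) :
    Continuous fun a => interp I η M (v a) (y a) := by
  unfold interp hat
  refine Continuous.div ?_ ?_ fun a => (hI.sum_hat_pos hM (y a)).ne'
  · exact continuous_finsetSum _ fun s hs => Continuous.mul (by fun_prop) (hv s hs)
  · exact continuous_finsetSum _ fun s hs => by fun_prop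

/-- `interp` is a weighted mean of the values `v s`, and only grid points within `η` of `y` carry
weight. -/
theorem IsGrid.abs_sub_interp_le {I : Finset ℝ≥0} {η M ε a y : ℝ} (hI : IsGrid I η M)
    (hy0 : 0 ≤ y) (hyM : y ≤ M) {v : ℝ≥0 → ℝ}
    (h : ∀ s ∈ I, |y - (s : ℝ)| < η → |a - v s| ≤ ε) :
    |a - interp I η M v y| ≤ ε := by
  have hpos := hI.sum_hat_pos (hy0.trans hyM) y
  have hcl : max 0 (min y M) = y := by rw [min_eq_left hyM, max_eq_right hy0]
  rw [interp]
  rw [hcl] at hpos ⊢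
  have h1 : a - (∑ s ∈ I, hat η y s * v s) / ∑ s ∈ I, hat η y s
      = (∑ s ∈ I, hat η y s * (a - v s)) / ∑ s ∈ I, hat η y s := by
    simp only [mul_sub, Finset.sum_sub_distrib, ← Finset.sum_mul]
    field_simp
  rw [h1, abs_div, abs_of_pos hpos, div_le_iff₀ hpos, Finset.mul_sum]
  refine (Finset.abs_sum_le_sum_abs _ _).trans (Finset.sum_le_sum fun s hs => ?_)
  rw [abs_mul, abs_of_nonneg (hat_nonneg _ _ _), mul_comm]
  by_cases h0 : hat η y s = 0
  · simp [h0]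
  · exact mul_le_mul_of_nonneg_right (h s hs (abs_sub_lt_of_hat_ne_zero h0)) (hat_nonneg _ _ _)

/-- Grids can be taken from any dense set of times. -/
theorem exists_isGrid {S : Set ℝ≥0} (hS : Dense S) {η : ℝ} (hη : 0 < η) (M : ℝ≥0) :
    ∃ I : Finset ℝ≥0, (I : Set ℝ≥0) ⊆ S ∧ (∀ s ∈ I, s < M + 1) ∧ IsGrid I η M := by
  have hK : IsCompact (Icc (0 : ℝ≥0) M) := isCompact_Icc
  -- The margin up to `M + 1` leaves room for points of `S` near every `y ≤ M`, also when `M = 0`.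
  obtain ⟨b, hb, hbf, hcov⟩ := hK.elim_finite_subcover_image (b := S ∩ Iio (M + 1))
    (c := fun s : ℝ≥0 => Metric.ball s η) (fun s _ => Metric.isOpen_ball) (fun y hy => by
      have ho : IsOpen (Metric.ball y η ∩ Iio (M + 1)) := Metric.isOpen_ball.inter isOpen_Iio
      obtain ⟨s, hs, hsS⟩ := hS.inter_open_nonempty _ ho
        ⟨y, Metric.mem_ball_self hη, hy.2.trans_lt (lt_add_one M)⟩
      exact mem_iUnion₂.2 ⟨s, ⟨hsS, hs.2⟩, by rw [Metric.mem_ball_comm]; exact hs.1⟩)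
  refine ⟨hbf.toFinset, fun s hs => (hb (by simpa using hs)).1,
    fun s hs => (hb (by simpa using hs)).2, fun y hy0 hyM => ?_⟩
  obtain ⟨s, hs, hys⟩ := mem_iUnion₂.1 (hcov (a := y.toNNReal)
    ⟨bot_le, by rwa [Real.toNNReal_le_iff_le_coe]⟩)
  refine ⟨s, by simpa using hs, ?_⟩
  rw [Metric.mem_ball, NNReal.dist_eq, Real.coe_toNNReal _ hy0] at hys
  exact hys

/-! ### Comparison of products and of expectations -/

/-- Telescoping: factors are exchanged one at a time while the others stay bounded by one. -/
theorem abs_prod_sub_prod_le {ι : Type*} (I : Finset ι) {a b : ι → ℝ} (ha : ∀ i ∈ I, |a i| ≤ 1)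
    (hb : ∀ i ∈ I, |b i| ≤ 1) : |∏ i ∈ I, a i - ∏ i ∈ I, b i| ≤ ∑ i ∈ I, |a i - b i| := by
  classical
  induction I using Finset.induction_on with
  | empty => simp
  | insert j I hj ih =>
    rw [Finset.prod_insert hj, Finset.prod_insert hj, Finset.sum_insert hj]
    have ih' := ih (fun i hi => ha i (Finset.mem_insert_of_mem hi))
      (fun i hi => hb i (Finset.mem_insert_of_mem hi))
    have h1 : a j * ∏ i ∈ I, a i - b j * ∏ i ∈ I, b i
        = (a j - b j) * ∏ i ∈ I, a i + b j * (∏ i ∈ I, a i - ∏ i ∈ I, b i) := by ring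
    have h2 : |∏ i ∈ I, a i| ≤ 1 := by
      rw [Finset.abs_prod]
      exact Finset.prod_le_one (fun _ _ => abs_nonneg _)
        fun i hi => ha i (Finset.mem_insert_of_mem hi)
    rw [h1]
    refine (abs_add_le _ _).trans (add_le_add ?_ ?_)
    · rw [abs_mul]
      exact mul_le_of_le_one_right (abs_nonneg _) h2
    · rw [abs_mul]
      exact (mul_le_of_le_one_left (abs_nonneg _) (hb j (Finset.mem_insert_self _ _))).trans ih'

/-- Two bounded random variables that are close off an event of small outer probability have close
expectations. -/
theorem abs_integral_sub_le {Ω : Type*} [MeasurableSpace Ω] {P : Measure Ω}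
    [IsProbabilityMeasure P] {f g : Ω → ℝ} (hf : AEStronglyMeasurable f P)
    (hg : AEStronglyMeasurable g P)
    {C η c : ℝ} (hη : 0 ≤ η) (hc : 0 ≤ c) (hfC : ∀ ω, |f ω| ≤ C) (hgC : ∀ ω, |g ω| ≤ C) {E : Set Ω}
    (hE : P E ≤ ENNReal.ofReal c) (h : ∀ ω ∉ E, |f ω - g ω| ≤ η) :
    |∫ ω, f ω ∂P - ∫ ω, g ω ∂P| ≤ η + 2 * C * c := by
  have hC : 0 ≤ C := by
    obtain ⟨ω⟩ : Nonempty Ω := P.nonempty_of_neZero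
    exact (abs_nonneg _).trans (hfC ω)
  have hif : Integrable f P := Integrable.of_bound hf C (Eventually.of_forall hfC)
  have hig : Integrable g P := Integrable.of_bound hg C (Eventually.of_forall hgC)
  -- `E` may involve uncountably many times and need not be measurable; its measurable hull has the
  -- same measure.
  set A := toMeasurable P E with hA
  have hAm : MeasurableSet A := measurableSet_toMeasurable _ _
  have hAP : P.real A ≤ c := by
    rw [measureReal_def, hA, measure_toMeasurable]
    exact ENNReal.toReal_le_of_le_ofReal hc hE
  rw [← integral_sub hif hig]
  have hint : Integrable (fun ω => η + A.indicator (fun _ => 2 * C) ω) P :=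
    (integrable_const η).add ((integrable_const _).indicator hAm)
  calc |∫ ω, (f ω - g ω) ∂P| ≤ ∫ ω, |f ω - g ω| ∂P := abs_integral_le_integral_abs
    _ ≤ ∫ ω, (η + A.indicator (fun _ => 2 * C) ω) ∂P := by
      refine integral_mono (hif.sub hig).abs hint fun ω => ?_
      by_cases hω : ω ∈ A
      · simp only [indicator_of_mem hω]
        have h1 := abs_sub (f ω) (g ω)
        have h2 := hfC ω
        have h3 := hgC ω
        linarith
      · simp only [indicator_of_notMem hω, add_zero]
        exact h ω fun h' => hω (subset_toMeasurable P E h')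
    _ = η + P.real A * (2 * C) := by
      rw [integral_add (integrable_const η) ((integrable_const _).indicator hAm),
        integral_indicator_const _ hAm]
      simp
    _ ≤ η + 2 * C * c := by nlinarith

/-! ### Consequences of convergence in distribution -/

section Distribution

variable {Ω : ℕ → Type*} {Ω' : Type*} [∀ n, MeasurableSpace (Ω n)] [MeasurableSpace Ω']
  {μ : (n : ℕ) → Measure (Ω n)} [∀ n, IsProbabilityMeasure (μ n)]
  {μ' : Measure Ω'} [IsProbabilityMeasure μ']
  {E : Type*} [TopologicalSpace E] [MeasurableSpace E]

theorem tendsto_integral_of_tendstoInDistribution [OpensMeasurableSpace E]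
    {Z : (n : ℕ) → Ω n → E} {Z' : Ω' → E}
    (h : TendstoInDistribution Z atTop Z' μ μ') {F : E → ℝ} (hF : Continuous F) {C : ℝ}
    (hC : ∀ x, |F x| ≤ C) :
    Tendsto (fun n => ∫ ω, F (Z n ω) ∂(μ n)) atTop (𝓝 (∫ ω, F (Z' ω) ∂μ')) := by
  have h1 := ProbabilityMeasure.tendsto_iff_forall_integral_tendsto.1 h.tendsto
    (BoundedContinuousFunction.ofNormedAddCommGroup F hF C hC)
  simp only [BoundedContinuousFunction.coe_ofNormedAddCommGroup, ProbabilityMeasure.coe_mk] at h1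
  rw [integral_map h.aemeasurable_limit hF.measurable.aestronglyMeasurable] at h1
  refine h1.congr fun n => ?_
  rw [integral_map (h.forall_aemeasurable n) hF.measurable.aestronglyMeasurable]

theorem eventually_measure_lt_of_isClosed [OpensMeasurableSpace E] [HasOuterApproxClosed E]
    {Z : (n : ℕ) → Ω n → E} {Z' : Ω' → E}
    (h : TendstoInDistribution Z atTop Z' μ μ') {K : Set E} (hK : IsClosed K) {c : ℝ≥0∞}
    (hc : μ' (Z' ⁻¹' K) < c) : ∀ᶠ n in atTop, μ n (Z n ⁻¹' K) < c := by
  have h1 := ProbabilityMeasure.limsup_measure_closed_le_of_tendsto h.tendsto hK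
  simp only [ProbabilityMeasure.coe_mk] at h1
  rw [Measure.map_apply_of_aemeasurable h.aemeasurable_limit hK.measurableSet] at h1
  filter_upwards [eventually_lt_of_limsup_lt (h1.trans_lt hc)] with n hn
  rwa [Measure.map_apply_of_aemeasurable (h.forall_aemeasurable n) hK.measurableSet] at hn

theorem measure_le_of_isOpen [OpensMeasurableSpace E] [HasOuterApproxClosed E]
    {Z : (n : ℕ) → Ω n → E} {Z' : Ω' → E}
    (h : TendstoInDistribution Z atTop Z' μ μ') {U : Set E} (hU : IsOpen U) {c : ℝ≥0∞}
    (hc : ∀ᶠ n in atTop, μ n (Z n ⁻¹' U) ≤ c) : μ' (Z' ⁻¹' U) ≤ c := by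
  have h1 := ProbabilityMeasure.le_liminf_measure_open_of_tendsto h.tendsto hU
  simp only [ProbabilityMeasure.coe_mk] at h1
  rw [Measure.map_apply_of_aemeasurable h.aemeasurable_limit hU.measurableSet] at h1
  refine h1.trans (liminf_le_of_frequently_le' (Eventually.frequently ?_))
  filter_upwards [hc] with n hn
  rwa [Measure.map_apply_of_aemeasurable (h.forall_aemeasurable n) hU.measurableSet]

/-- A sequence of random variables that converges in distribution is asymptotically tight. -/
theorem exists_nat_measure_lt {W : (n : ℕ) → Ω n → ℝ} {W' : Ω' → ℝ}
    (h : TendstoInDistribution W atTop W' μ μ') {c : ℝ≥0∞} (hc : 0 < c) :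
    ∃ M : ℕ, μ' {ω | (M : ℝ) ≤ |W' ω|} < c ∧ ∀ᶠ n in atTop, μ n {ω | (M : ℝ) ≤ |W n ω|} < c := by
  have hcl : ∀ M : ℕ, IsClosed {x : ℝ | (M : ℝ) ≤ |x|} :=
    fun M => isClosed_le continuous_const continuous_abs
  have h1 : Tendsto (μ' ∘ fun M : ℕ => W' ⁻¹' {x : ℝ | (M : ℝ) ≤ |x|}) atTop
      (𝓝 (μ' (⋂ M : ℕ, W' ⁻¹' {x : ℝ | (M : ℝ) ≤ |x|}))) := by
    refine tendsto_measure_iInter_atTop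
      (fun M => h.aemeasurable_limit.nullMeasurable (hcl M).measurableSet) ?_
      ⟨0, measure_ne_top _ _⟩
    intro M M' hM ω hω
    exact (Nat.cast_le.2 hM).trans (show (M' : ℝ) ≤ |W' ω| from hω)
  have h2 : (⋂ M : ℕ, W' ⁻¹' {x : ℝ | (M : ℝ) ≤ |x|}) = ∅ := by
    refine eq_empty_of_forall_notMem fun ω hω => ?_
    obtain ⟨M, hM⟩ := exists_nat_gt |W' ω|
    exact hM.not_ge (mem_iInter.1 hω M)
  rw [h2, measure_empty] at h1
  obtain ⟨M, hM⟩ := (h1.eventually (gt_mem_nhds hc)).exists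
  exact ⟨M, hM, eventually_measure_lt_of_isClosed h (hcl M) hM⟩

end Distribution

/-! ### Paths -/

/-- The oscillations of `x` over time spans shorter than `δ` before `T` are at most `η`. -/
def OscLe (x : ℝ≥0 → ℝ) (δ η : ℝ) (T : ℝ≥0) : Prop :=
  ∀ s t : ℝ≥0, s < T → t < T → |(s : ℝ) - t| < δ → |x s - x t| ≤ η

theorem oscLe_of_modulus_le {x : ℝ≥0 → ℝ} {δ η : ℝ} {T : ℝ≥0} (hη : 0 ≤ η)
    (h : modulus gapC x δ T ≤ ENNReal.ofReal η) : OscLe x δ η T :=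
  fun _ _ hs ht hst => abs_sub_le_of_modulus_le hη h hs.le ht.le hst

/-- The sequence descends to `t`, so right-continuity suffices. This reduces events over all times
to countably many times. -/
theorem exists_seq_dense_of_rightCont {x : ℝ≥0 → ℝ} {S : Set ℝ≥0} (hS : Dense S) {t : ℝ≥0}
    (hx : ContinuousWithinAt x (Ici t) t) : ∃ u : ℕ → ℝ≥0, (∀ n, u n ∈ S) ∧
      Tendsto u atTop (𝓝 t) ∧ Tendsto (fun n => x (u n)) atTop (𝓝 (x t)) := by
  obtain ⟨u, -, hu, hlim⟩ := hS.exists_seq_strictAnti_tendsto_of_lt (lt_add_one t)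
  exact ⟨u, fun n => (hu n).2, hlim, hx.tendsto.comp
    (tendsto_nhdsWithin_iff.2 ⟨hlim, Eventually.of_forall fun n => (hu n).1.1.le⟩)⟩

/-- A large oscillation of a right-continuous path is visible on any dense set of times. -/
theorem exists_mem_dense_of_not_oscLe {x : ℝ≥0 → ℝ} (hx : IsCadlag x) {S : Set ℝ≥0} (hS : Dense S)
    {δ η : ℝ} {T : ℝ≥0} (h : ¬ OscLe x δ η T) :
    ∃ s ∈ S, ∃ t ∈ S, s < T ∧ t < T ∧ |(s : ℝ) - t| < δ ∧ η < |x s - x t| := by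
  unfold OscLe at h
  push Not at h
  obtain ⟨s, t, hs, ht, hst, hη⟩ := h
  obtain ⟨u, huS, hu, hxu⟩ := exists_seq_dense_of_rightCont hS (hx s).1
  obtain ⟨v, hvS, hv, hxv⟩ := exists_seq_dense_of_rightCont hS (hx t).1
  have h1 : Tendsto (fun n => |(u n : ℝ) - v n|) atTop (𝓝 |(s : ℝ) - t|) :=
    (((NNReal.continuous_coe.tendsto s).comp hu).sub
      ((NNReal.continuous_coe.tendsto t).comp hv)).abs
  obtain ⟨n, h1, h2, h3, h4⟩ := ((hu.eventually (gt_mem_nhds hs)).and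
    ((hv.eventually (gt_mem_nhds ht)).and ((h1.eventually (gt_mem_nhds hst)).and
      ((hxu.sub hxv).abs.eventually (lt_mem_nhds hη))))).exists
  exact ⟨u n, huS n, v n, hvS n, h1, h2, h3, h4⟩

/-- The composition with a non-decreasing path is right-continuous. -/
theorem compFun_rightCont (x : CadlagPath) {y : CadlagPath} (hy : Monotone y.toFun) (t : ℝ≥0) :
    ContinuousWithinAt (compFun x y) (Ici t) t := by
  have h1 : ContinuousWithinAt (fun t => (y t).toNNReal) (Ici t) t :=
    continuous_real_toNNReal.continuousAt.comp_continuousWithinAt (y.cadlag t).1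
  -- Monotonicity of `y` makes the inner values approach from the right, the side on which `x` is
  -- continuous.
  exact (x.cadlag _).1.comp h1 fun s hs => Real.toNNReal_le_toNNReal (hy hs)

theorem exists_bound_compFun (x y : CadlagPath) (T : ℝ≥0) :
    ∃ C : ℝ, ∀ t ≤ T, |compFun x y t| ≤ C := by
  obtain ⟨C, hC⟩ := y.cadlag.exists_bound T
  obtain ⟨C', hC'⟩ := x.cadlag.exists_bound C.toNNReal
  exact ⟨C', fun t ht => hC' _ (Real.toNNReal_le_toNNReal ((le_abs_self _).trans (hC t ht)))⟩

/-- Clipping to `[0, M]`. -/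
noncomputable def clip (M y : ℝ) : ℝ := max 0 (min y M)

theorem clip_mono (M : ℝ) : Monotone (clip M) :=
  fun _ _ h => max_le_max le_rfl (min_le_min h le_rfl)

@[fun_prop]
theorem continuous_clip (M : ℝ) : Continuous (clip M) := by unfold clip; fun_prop

theorem abs_clip_le {M : ℝ} (hM : 0 ≤ M) (y : ℝ) : |clip M y| ≤ M := by
  rw [clip, abs_of_nonneg (le_max_left _ _)]
  exact max_le hM (min_le_right _ _)

/-- On a good event the composition is close to a continuous function of finitely many values. -/
theorem abs_compFun_sub_interp_le {x y : CadlagPath} (hy : IsUnboundedIncreasing y)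
    {s t s' r M : ℝ≥0} {η ε : ℝ} (hst : s ≤ t) (hts : t ≤ s') (hsr : s' ≤ r) (hr : y r < M)
    (hclip : clip M (y s') - clip M (y s) < η) (hosc : OscLe x (2 * η) ε (M + 1))
    {I : Finset ℝ≥0} (hIM : ∀ i ∈ I, i < M + 1) (hI : IsGrid I η M) :
    |compFun x y t - interp I η M x (y s)| ≤ ε := by
  obtain ⟨hpos, hmono, -⟩ := hy
  have h1 := hmono hst
  have h2 := hmono hts
  have h3 := hmono hsr
  have hM : y s' < M := h3.trans_lt hr
  -- Both values lie in `[0, M]`, where clipping is inactive: `hclip` bounds the true increment.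
  rw [clip, clip, min_eq_left hM.le, min_eq_left ((h1.trans h2).trans hM.le), max_eq_right (hpos _),
    max_eq_right (hpos _)] at hclip
  refine hI.abs_sub_interp_le (hpos s) ((h1.trans h2).trans hM.le) fun i hi hsi => ?_
  -- Both `y t` and the grid point `i` are within `η` of `y s`, hence the span `2 * η`.
  refine hosc _ _ ?_ (hIM i hi) ?_
  · refine lt_of_le_of_lt ?_ (lt_add_one M)
    rw [Real.toNNReal_le_iff_le_coe]
    exact h2.trans hM.le
  · rw [Real.coe_toNNReal _ (hpos t)]
    have := abs_sub_le (y t) (y s) i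
    rw [abs_of_nonneg (sub_nonneg.2 h1)] at this
    linarith

/-! ### Estimates for a single pair of processes -/

section SingleSpace

variable {Ω : Type*} [MeasurableSpace Ω] {P : Measure Ω} [IsProbabilityMeasure P]
  {X Y : Ω → CadlagPath}

/-- Applied both along the sequence and to the limit, this replaces the composition by a function of
finitely many values. Off an event of probability at most `(card ι + 2) * c` every factor moves by
at most `ε`; on that event the products differ by at most `2`. -/
theorem abs_integral_prod_compFun_sub_le
    (hX : ∀ t, Measurable fun ω => X ω t) (hY : ∀ t, Measurable fun ω => Y ω t)
    (hinc : ∀ᵐ ω ∂P, IsUnboundedIncreasing (Y ω)) {ι : Type*} [Fintype ι] {s t s' : ι → ℝ≥0}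
    {r M : ℝ≥0} {η ε c : ℝ} (hε : 0 ≤ ε) (hc : 0 ≤ c)
    (hst : ∀ i, s i ≤ t i) (hts : ∀ i, t i ≤ s' i) (hsr : ∀ i, s' i ≤ r)
    {g : ι → ℝ → ℝ} (hg : ∀ i x, |g i x| ≤ 1) (hg' : ∀ i, LipschitzWith 1 (g i))
    {I : Finset ℝ≥0} (hIM : ∀ i ∈ I, i < M + 1) (hI : IsGrid I η M)
    (hr : P {ω | (M : ℝ) ≤ |Y ω r|} ≤ ENNReal.ofReal c)
    (hosc : P {ω | ¬ OscLe (X ω) (2 * η) ε (M + 1)} ≤ ENNReal.ofReal c)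
    (hclip : ∀ i, P {ω | η ≤ clip M (Y ω (s' i)) - clip M (Y ω (s i))} ≤ ENNReal.ofReal c) :
    |∫ ω, ∏ i, g i (compFun (X ω) (Y ω) (t i)) ∂P
      - ∫ ω, ∏ i, g i (interp I η M (X ω) (Y ω (s i))) ∂P|
      ≤ Fintype.card ι * ε + 2 * ((Fintype.card ι + 2) * c) := by
  have hb : ∀ u : ι → ℝ, |∏ i, g i (u i)| ≤ 1 := fun u => by
    rw [Finset.abs_prod]
    exact Finset.prod_le_one (fun _ _ => abs_nonneg _) fun i _ => hg i _
  have hm1 : Measurable fun ω => ∏ i, g i (compFun (X ω) (Y ω) (t i)) :=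
    Finset.measurable_fun_prod _ fun i _ => (hg' i).continuous.measurable.comp
      ((measurable_uncurry_compFun hX hY).comp (measurable_id.prodMk measurable_const))
  have hm2 : Measurable fun ω => ∏ i, g i (interp I η M (X ω) (Y ω (s i))) := by
    refine Finset.measurable_fun_prod _ fun i _ => (hg' i).continuous.measurable.comp ?_
    -- The extension by zero is immaterial, since `interp` reads grid values only.
    have h1 : Continuous fun a : (I → ℝ) × ℝ =>
        interp I η M (fun j => if h : j ∈ I then a.1 ⟨j, h⟩ else 0) a.2 := by
      refine hI.continuous_interp M.2 (fun j hj => ?_) continuous_snd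
      simp only [hj, dite_true]
      fun_prop
    have h2 : Measurable fun ω => ((fun j : I => X ω j, Y ω (s i)) : (I → ℝ) × ℝ) :=
      (measurable_pi_lambda (fun ω (j : I) => X ω j) fun j => hX j).prodMk (hY (s i))
    convert h1.measurable.comp h2 using 1
    funext ω
    simp only [Function.comp_apply, interp]
    congr 1
    exact Finset.sum_congr rfl fun j hj => by simp [hj]
  set N := {ω | ¬ IsUnboundedIncreasing (Y ω)} with hN
  have hN0 : P N = 0 := hinc
  have hE : P (N ∪ {ω | (M : ℝ) ≤ |Y ω r|} ∪ {ω | ¬ OscLe (X ω) (2 * η) ε (M + 1)} ∪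
      ⋃ i, {ω | η ≤ clip M (Y ω (s' i)) - clip M (Y ω (s i))})
      ≤ ENNReal.ofReal ((Fintype.card ι + 2) * c) := by
    calc _ ≤ P N + P {ω | (M : ℝ) ≤ |Y ω r|} + P {ω | ¬ OscLe (X ω) (2 * η) ε (M + 1)} +
          P (⋃ i, {ω | η ≤ clip M (Y ω (s' i)) - clip M (Y ω (s i))}) := by
          refine (measure_union_le _ _).trans (add_le_add_left ?_ _)
          refine (measure_union_le _ _).trans (add_le_add_left ?_ _)
          exact measure_union_le _ _
      _ ≤ 0 + ENNReal.ofReal c + ENNReal.ofReal c + Fintype.card ι * ENNReal.ofReal c := by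
          gcongr
          · exact hN0.le
          · refine (measure_iUnion_fintype_le _ _).trans ?_
            refine (Finset.sum_le_sum fun i _ => hclip i).trans ?_
            simp
      _ = _ := by
          rw [ENNReal.ofReal_mul (by positivity), ENNReal.ofReal_add (by positivity) (by norm_num)]
          simp only [ENNReal.ofReal_natCast, ENNReal.ofReal_ofNat]
          ring
  have := abs_integral_sub_le (P := P) hm1.aestronglyMeasurable hm2.aestronglyMeasurable
    (η := Fintype.card ι * ε) (C := 1) (by positivity) (by positivity) (fun ω => hb _)
    (fun ω => hb _) hE ?_
  · linarith
  intro ω hω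
  simp only [mem_union, mem_iUnion, mem_ofPred_eq, not_or, not_exists, not_le, not_not, hN] at hω
  obtain ⟨⟨⟨h1, h2⟩, h3⟩, h4⟩ := hω
  refine (abs_prod_sub_prod_le _ (fun i _ => hg i _) (fun i _ => hg i _)).trans ?_
  have h5 : ∀ i ∈ (Finset.univ : Finset ι), |g i (compFun (X ω) (Y ω) (t i))
      - g i (interp I η M (X ω) (Y ω (s i)))| ≤ ε := fun i _ => by
    have h6 := (hg' i).dist_le_mul (compFun (X ω) (Y ω) (t i)) (interp I η M (X ω) (Y ω (s i)))
    rw [Real.dist_eq, Real.dist_eq, NNReal.coe_one, one_mul] at h6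
    exact h6.trans (abs_compFun_sub_interp_le h1 (hst i) (hts i) (hsr i)
      ((le_abs_self _).trans_lt h2) (h4 i) h3 hIM hI)
  refine (Finset.sum_le_sum h5).trans ?_
  simp

theorem integrable_clip {M : ℝ} (hM : 0 ≤ M) (hY : ∀ t, Measurable fun ω => Y ω t) (t : ℝ≥0) :
    Integrable (fun ω => clip M (Y ω t)) P :=
  Integrable.of_bound ((continuous_clip M).measurable.comp (hY t)).aestronglyMeasurable M
    (Eventually.of_forall fun _ => abs_clip_le hM _)

/-- Markov's inequality for the increments of a clipped non-decreasing process. -/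
theorem measure_clip_sub_le (hY : ∀ t, Measurable fun ω => Y ω t)
    (hinc : ∀ᵐ ω ∂P, IsUnboundedIncreasing (Y ω)) {M η c : ℝ} (hM : 0 ≤ M) (hη : 0 < η)
    {s s' : ℝ≥0} (hs : s ≤ s')
    (h : ∫ ω, (clip M (Y ω s') - clip M (Y ω s)) ∂P ≤ η * c) :
    P {ω | η ≤ clip M (Y ω s') - clip M (Y ω s)} ≤ ENNReal.ofReal c := by
  have h1 := mul_meas_ge_le_integral_of_nonneg (μ := P)
    (f := fun ω => clip M (Y ω s') - clip M (Y ω s))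
    (hinc.mono fun ω hω => sub_nonneg.2 (clip_mono M (hω.2.1 hs)))
    ((integrable_clip hM hY s').sub (integrable_clip hM hY s)) η
  have h2 : P.real {ω | η ≤ clip M (Y ω s') - clip M (Y ω s)} ≤ c :=
    le_of_mul_le_mul_left (h1.trans h) hη
  rw [← ENNReal.ofReal_toReal (measure_ne_top P _)]
  exact ENNReal.ofReal_le_ofReal h2

/-- A time at which the law of `Y` has no jump, in a form adapted to a dense set `S` of times. -/
def IsRegularTime (P : Measure Ω) (Y : Ω → CadlagPath) (S : Set ℝ≥0) (t : ℝ≥0) : Prop :=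
  ∀ M : ℕ, ∀ c : ℝ, 0 < c → ∃ s ∈ S, ∃ s' ∈ S, s ≤ t ∧ t ≤ s' ∧ s' ≤ t + 1 ∧
    ∫ ω, (clip M (Y ω s') - clip M (Y ω s)) ∂P < c

/-- Clipping makes the mean of `Y t` finite, and this mean is monotone in `t`, so it has countably
many discontinuities for each integer `M`. At any other positive time, points of `S` close in from
both sides. -/
theorem ae_isRegularTime (hY : ∀ t, Measurable fun ω => Y ω t)
    (hinc : ∀ᵐ ω ∂P, IsUnboundedIncreasing (Y ω)) {S : Set ℝ≥0} (hS : Dense S) :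
    ∀ᵐ t ∂lebesgue, IsRegularTime P Y S t := by
  let ψ : ℕ → ℝ≥0 → ℝ := fun M t => ∫ ω, clip M (Y ω t) ∂P
  have hψ : ∀ M, Monotone (ψ M) := fun M s t hst =>
    integral_mono_ae (integrable_clip (Nat.cast_nonneg M) hY s)
      (integrable_clip (Nat.cast_nonneg M) hY t) (hinc.mono fun ω hω => clip_mono M (hω.2.1 hst))
  have h1 : ∀ᵐ t ∂lebesgue, ∀ M, ContinuousAt (ψ M) t :=
    ae_all_iff.2 fun M => ((hψ M).countable_not_continuousAt.measure_zero lebesgue)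
  have h2 : ∀ᵐ t ∂lebesgue, t ≠ 0 := by
    rw [ae_iff]
    simp
  filter_upwards [h1, h2] with t ht ht0 M c hc
  have hpos : 0 < t := pos_iff_ne_zero.2 ht0
  obtain ⟨u, -, hu, hulim⟩ := hS.exists_seq_strictMono_tendsto_of_lt hpos
  obtain ⟨v, -, hv, hvlim⟩ := hS.exists_seq_strictAnti_tendsto_of_lt (lt_add_one t)
  have h3 : Tendsto (fun n => ψ M (v n) - ψ M (u n)) atTop (𝓝 (ψ M t - ψ M t)) :=
    ((ht M).tendsto.comp hvlim).sub ((ht M).tendsto.comp hulim)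
  rw [sub_self] at h3
  obtain ⟨n, hn⟩ := (h3.eventually (gt_mem_nhds hc)).exists
  refine ⟨u n, (hu n).2, v n, (hv n).2, (hu n).1.2.le, (hv n).1.1.le, (hv n).1.2.le, ?_⟩
  rwa [integral_sub (integrable_clip (Nat.cast_nonneg M) hY _)
    (integrable_clip (Nat.cast_nonneg M) hY _)]

/-- The paths of `X ∘ Y` on `[0, T)` are bounded by a constant with large probability. -/
theorem exists_measure_compFun_gt_le
    (hX : ∀ t, Measurable fun ω => X ω t) (hY : ∀ t, Measurable fun ω => Y ω t)
    (hinc : ∀ᵐ ω ∂P, IsUnboundedIncreasing (Y ω)) (T : ℝ≥0) {c : ℝ≥0∞} (hc : 0 < c) :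
    ∃ C : ℕ, P {ω | ∃ t < T, (C : ℝ) < |compFun (X ω) (Y ω) t|} ≤ c := by
  -- Over a countable dense set the exceedance events are measurable, and they decrease to `∅`
  -- because each path is bounded before `T`.
  obtain ⟨Q, hQc, hQ⟩ := TopologicalSpace.exists_countable_dense ℝ≥0
  let A : ℕ → Set Ω := fun C => ⋃ q ∈ Q ∩ Iio T, {ω | (C : ℝ) < |compFun (X ω) (Y ω) q|}
  have hA : ∀ C, MeasurableSet (A C) := fun C =>
    MeasurableSet.biUnion (hQc.mono inter_subset_left) fun q _ =>
      measurableSet_lt measurable_const ((measurable_uncurry_compFun hX hY).comp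
        (measurable_id.prodMk measurable_const)).abs
  have h1 : Tendsto (P ∘ A) atTop (𝓝 (P (⋂ C, A C))) := by
    refine tendsto_measure_iInter_atTop (fun C => (hA C).nullMeasurableSet) ?_
      ⟨0, measure_ne_top _ _⟩
    intro C C' hCC ω hω
    obtain ⟨q, hq, h⟩ := mem_iUnion₂.1 hω
    exact mem_iUnion₂.2 ⟨q, hq, show (C : ℝ) < |compFun (X ω) (Y ω) q| from
      (Nat.cast_le.2 hCC).trans_lt (show (C' : ℝ) < |compFun (X ω) (Y ω) q| from h)⟩
  have h2 : (⋂ C, A C) = ∅ := by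
    refine eq_empty_of_forall_notMem fun ω hω => ?_
    obtain ⟨C, hC⟩ := exists_bound_compFun (X ω) (Y ω) T
    obtain ⟨m, hm⟩ := exists_nat_ge C
    obtain ⟨q, hq, h⟩ := mem_iUnion₂.1 (mem_iInter.1 hω m)
    exact ((hC q hq.2.le).trans hm).not_gt h
  rw [h2, measure_empty] at h1
  obtain ⟨C, hC⟩ := (h1.eventually (gt_mem_nhds hc)).exists
  refine ⟨C, le_trans (measure_mono_ae ?_) hC.le⟩
  filter_upwards [hinc] with ω hω
  rintro ⟨t, htT, ht⟩
  obtain ⟨u, huQ, hu, hxu⟩ := exists_seq_dense_of_rightCont hQ (compFun_rightCont (X ω) hω.2.1 t)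
  obtain ⟨n, h3, h4⟩ := ((hu.eventually (gt_mem_nhds htT)).and
    (hxu.abs.eventually (lt_mem_nhds ht))).exists
  exact mem_iUnion₂.2 ⟨u n, ⟨huQ n, h3⟩, h4⟩

end SingleSpace

/-! ### Passage to the limit along the sequence -/

/-- Asymptotic equicontinuity of a sequence that is tight for the `𝒞`-topology. -/
theorem exists_eventually_measure_not_oscLe_le {Ω : ℕ → Type*} [∀ n, MeasurableSpace (Ω n)]
    {μ : (n : ℕ) → Measure (Ω n)} {X : (n : ℕ) → Ω n → CadlagPath}
    (hmod : ∀ ε : ℝ≥0∞, 0 < ε → ∀ T : ℝ≥0, 0 < T →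
      Tendsto (fun δ : ℝ => limsup (fun n => μ n {ω | ε < modulus gapC (fun t => X n ω t) δ T})
        atTop) (𝓝[>] 0) (𝓝 0))
    {η : ℝ} (hη : 0 < η) {T : ℝ≥0} (hT : 0 < T) {c : ℝ≥0∞} (hc : 0 < c) :
    ∃ δ > 0, ∀ᶠ n in atTop, μ n {ω | ¬ OscLe (X n ω) δ η T} ≤ c := by
  have h := hmod (ENNReal.ofReal η) (ENNReal.ofReal_pos.2 hη) T hT
  obtain ⟨δ, h1, h2⟩ := ((h.eventually (gt_mem_nhds hc)).and self_mem_nhdsWithin).exists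
  refine ⟨δ, h2, ?_⟩
  filter_upwards [eventually_lt_of_limsup_lt h1] with n hn
  refine (measure_mono fun ω hω => ?_).trans hn.le
  by_contra h3
  exact hω (oscLe_of_modulus_le hη.le (not_lt.1 h3))

section Sequence

variable {Ω : ℕ → Type*} {Ω' : Type*} [∀ n, MeasurableSpace (Ω n)] [MeasurableSpace Ω']
  {μ : (n : ℕ) → Measure (Ω n)} [∀ n, IsProbabilityMeasure (μ n)]
  {μ' : Measure Ω'} [IsProbabilityMeasure μ']
  {X Y : (n : ℕ) → Ω n → CadlagPath} {X' Y' : Ω' → CadlagPath} {S : Set ℝ≥0}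

/-- The limit of an asymptotically equicontinuous sequence has small oscillations. -/
theorem measure_not_oscLe_le (hS : Dense S)
    (hfdd : ∀ I : Finset ℝ≥0, (I : Set ℝ≥0) ⊆ S → TendstoInDistribution
      (fun n ω (t : I) => (X n ω t, Y n ω t)) atTop (fun ω (t : I) => (X' ω t, Y' ω t)) μ μ')
    {δ η : ℝ} {T : ℝ≥0} {c : ℝ≥0∞}
    (h : ∀ᶠ n in atTop, μ n {ω | ¬ OscLe (X n ω) δ η T} ≤ c) :
    μ' {ω | ¬ OscLe (X' ω) δ η T} ≤ c := by
  obtain ⟨Q, hQS, hQc, hQ⟩ := hS.exists_countable_dense_subset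
  obtain ⟨e, he⟩ := hQc.exists_eq_range hQ.nonempty
  classical
  let I : ℕ → Finset ℝ≥0 := fun N => (Finset.range N).image e
  let A : ℕ → Set Ω' := fun N => {ω | ∃ s ∈ I N, ∃ t ∈ I N, s < T ∧ t < T ∧ |(s : ℝ) - t| < δ ∧
    η < |X' ω s - X' ω t|}
  have hmono : Monotone A := by
    rintro N N' hN ω ⟨s, hs, t, ht, h⟩
    have hsub : I N ⊆ I N' := Finset.image_subset_image (Finset.range_mono hN)
    exact ⟨s, hsub hs, t, hsub ht, h⟩
  have hcov : {ω | ¬ OscLe (X' ω) δ η T} ⊆ ⋃ N, A N := by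
    intro ω hω
    obtain ⟨s, hs, t, ht, h⟩ := exists_mem_dense_of_not_oscLe (X' ω).cadlag hQ hω
    rw [he] at hs ht
    obtain ⟨i, rfl⟩ := hs
    obtain ⟨j, rfl⟩ := ht
    refine mem_iUnion.2 ⟨max i j + 1, e i, ?_, e j, ?_, h⟩
    · exact Finset.mem_image_of_mem _ (Finset.mem_range.2 (by omega))
    · exact Finset.mem_image_of_mem _ (Finset.mem_range.2 (by omega))
  refine (measure_mono hcov).trans (le_of_tendsto' (tendsto_measure_iUnion_atTop hmono) fun N => ?_)
  have hI : (I N : Set ℝ≥0) ⊆ S := by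
    intro s hs
    obtain ⟨i, -, rfl⟩ := Finset.mem_image.1 (Finset.mem_coe.1 hs)
    exact hQS (he ▸ mem_range_self i)
  -- The strict inequality makes `U` open, so the portmanteau theorem bounds its limit probability.
  let U : Set (I N → ℝ × ℝ) := ⋃ s : I N, ⋃ t : I N, {v | ((s : ℝ≥0) < T ∧ (t : ℝ≥0) < T ∧
    |((s : ℝ≥0) : ℝ) - (t : ℝ≥0)| < δ) ∧ η < |(v s).1 - (v t).1|}
  have hU : IsOpen U := by
    refine isOpen_iUnion fun s => isOpen_iUnion fun t => IsOpen.and ?_ ?_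
    · exact isOpen_const
    · exact isOpen_lt continuous_const (by fun_prop)
  have hAU : A N ⊆ (fun ω (t : I N) => (X' ω t, Y' ω t)) ⁻¹' U := by
    rintro ω ⟨s, hs, t, ht, h1, h2, h3, h4⟩
    exact mem_iUnion₂.2 ⟨⟨s, hs⟩, ⟨t, ht⟩, ⟨h1, h2, h3⟩, h4⟩
  refine (measure_mono hAU).trans (measure_le_of_isOpen (hfdd (I N) hI) hU ?_)
  filter_upwards [h] with n hn
  refine (measure_mono ?_).trans hn
  intro ω hω hosc
  obtain ⟨s, t, ⟨h1, h2, h3⟩, h4⟩ := mem_iUnion₂.1 hω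
  exact h4.not_ge (hosc s t h1 h2 h3)

theorem tendstoInDistribution_fst_snd
    (hfdd : ∀ I : Finset ℝ≥0, (I : Set ℝ≥0) ⊆ S → TendstoInDistribution
      (fun n ω (t : I) => (X n ω t, Y n ω t)) atTop (fun ω (t : I) => (X' ω t, Y' ω t)) μ μ')
    {t : ℝ≥0} (ht : t ∈ S) :
    TendstoInDistribution (fun n ω => X n ω t) atTop (fun ω => X' ω t) μ μ' ∧
    TendstoInDistribution (fun n ω => Y n ω t) atTop (fun ω => Y' ω t) μ μ' := by
  have h := hfdd {t} (by simpa using ht)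
  let j : ({t} : Finset ℝ≥0) := ⟨t, Finset.mem_singleton_self t⟩
  exact ⟨h.continuous_comp (g := fun v : ({t} : Finset ℝ≥0) → ℝ × ℝ => (v j).1) (by fun_prop),
    h.continuous_comp (g := fun v : ({t} : Finset ℝ≥0) → ℝ × ℝ => (v j).2) (by fun_prop)⟩

/-- The compositions `Xₙ ∘ Yₙ` are uniformly bounded on bounded time sets with large probability. -/
theorem exists_forall_measure_compFun_gt_le (hS : Dense S) (hS0 : 0 ∈ S)
    (hX : ∀ n t, Measurable fun ω => X n ω t) (hY : ∀ n t, Measurable fun ω => Y n ω t)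
    (hX' : ∀ t, Measurable fun ω => X' ω t) (hY' : ∀ t, Measurable fun ω => Y' ω t)
    (hinc : ∀ n, ∀ᵐ ω ∂(μ n), IsUnboundedIncreasing (Y n ω))
    (hinc' : ∀ᵐ ω ∂μ', IsUnboundedIncreasing (Y' ω))
    (hmod : ∀ ε : ℝ≥0∞, 0 < ε → ∀ T : ℝ≥0, 0 < T →
      Tendsto (fun δ : ℝ => limsup (fun n => μ n {ω | ε < modulus gapC (fun t => X n ω t) δ T})
        atTop) (𝓝[>] 0) (𝓝 0))
    (hfdd : ∀ I : Finset ℝ≥0, (I : Set ℝ≥0) ⊆ S → TendstoInDistribution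
      (fun n ω (t : I) => (X n ω t, Y n ω t)) atTop (fun ω (t : I) => (X' ω t, Y' ω t)) μ μ')
    (T : ℝ≥0) {c : ℝ≥0∞} (hc : 0 < c) :
    ∃ C : ℕ, (∀ n, μ n {ω | ∃ t < T, (C : ℝ) < |compFun (X n ω) (Y n ω) t|} ≤ c) ∧
      μ' {ω | ∃ t < T, (C : ℝ) < |compFun (X' ω) (Y' ω) t|} ≤ c := by
  have hc3 : 0 < c / 3 := ENNReal.div_pos hc.ne' (by simp)
  obtain ⟨r, hrS, hTr, -⟩ := hS.exists_between (lt_add_one T)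
  obtain ⟨M, -, hM⟩ := exists_nat_measure_lt (tendstoInDistribution_fst_snd hfdd hrS).2 hc3
  obtain ⟨K, -, hK⟩ := exists_nat_measure_lt (tendstoInDistribution_fst_snd hfdd hS0).1 hc3
  obtain ⟨δ, hδ, hosc⟩ := exists_eventually_measure_not_oscLe_le hmod one_pos
    (T := (M : ℝ≥0) + 1) (by positivity) hc3
  -- From `0`, `j` steps of length `δ / 2` reach every point of `[0, M]`, each changing `Xₙ` by at
  -- most `1`. With `|Xₙ 0| < K` this gives the bound `K + j`.
  obtain ⟨j, hj⟩ := exists_nat_ge ((M : ℝ) / (δ / 2))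
  rw [div_le_iff₀ (by positivity)] at hj
  have hev : ∀ᶠ n in atTop,
      μ n {ω | ∃ t < T, ((K + j : ℕ) : ℝ) < |compFun (X n ω) (Y n ω) t|} ≤ c := by
    filter_upwards [hM, hK, hosc] with n h1 h2 h3
    let E : Set (Ω n) := {ω | (M : ℝ) ≤ |Y n ω r|} ∪ {ω | (K : ℝ) ≤ |X n ω 0|} ∪
      {ω | ¬ OscLe (X n ω) δ 1 (M + 1)}
    have h4 : μ n E ≤ c := by
      refine (measure_union_le _ _).trans ?_
      refine (add_le_add (measure_union_le _ _) le_rfl).trans ?_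
      exact (add_le_add (add_le_add h1.le h2.le) h3).trans (ENNReal.add_thirds c).le
    refine (measure_mono_ae ?_).trans h4
    filter_upwards [hinc n] with ω hω
    rintro ⟨t, htT, ht⟩
    by_contra hbad
    have hbad : ω ∉ E := hbad
    simp only [E, mem_union, mem_ofPred_eq, not_or, not_le, not_not] at hbad
    obtain ⟨⟨h5, h6⟩, h7⟩ := hbad
    have h8 : Y n ω t ≤ M := (hω.2.1 (htT.trans hTr).le).trans ((le_abs_self _).trans h5.le)
    have h9 := abs_sub_zero_le_of_osc hδ h7 j (Y n ω t).toNNReal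
      (lt_of_le_of_lt (by rw [Real.toNNReal_le_iff_le_coe]; exact_mod_cast h8) (lt_add_one _))
      (by rw [Real.coe_toNNReal _ (hω.1 t)]; exact h8.trans hj)
    have h10 := abs_sub_abs_le_abs_sub (X n ω (Y n ω t).toNNReal) (X n ω 0)
    change _ < |X n ω (Y n ω t).toNNReal| at ht
    push_cast at ht
    linarith
  obtain ⟨N, hN⟩ := eventually_atTop.1 hev
  -- The bound so far holds for large `n` only; the finitely many other indices and the limit get
  -- their own constants.
  choose f hf using fun n => exists_measure_compFun_gt_le (hX n) (hY n) (hinc n) T hc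
  obtain ⟨C', hC'⟩ := exists_measure_compFun_gt_le hX' hY' hinc' T hc
  refine ⟨max (max (K + j) C') ((Finset.range N).sup f), fun n => ?_, ?_⟩
  · rcases le_or_gt N n with hn | hn
    · refine (measure_mono ?_).trans (hN n hn)
      rintro ω ⟨t, ht, h⟩
      exact ⟨t, ht, (Nat.cast_le.2 ((le_max_left _ _).trans (le_max_left _ _))).trans_lt h⟩
    · refine (measure_mono ?_).trans (hf n)
      rintro ω ⟨t, ht, h⟩
      exact ⟨t, ht, (Nat.cast_le.2 ((Finset.le_sup (f := f) (Finset.mem_range.2 hn)).trans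
        (le_max_right _ _))).trans_lt h⟩
  · refine (measure_mono ?_).trans hC'
    rintro ω ⟨t, ht, h⟩
    exact ⟨t, ht, (Nat.cast_le.2 ((le_max_right _ _).trans (le_max_left _ _))).trans_lt h⟩

/-- Convergence of the finite-dimensional distributions of `Xₙ ∘ Yₙ` at regular times. -/
theorem tendsto_integral_prod_compFun (hS : Dense S)
    (hX : ∀ n t, Measurable fun ω => X n ω t) (hY : ∀ n t, Measurable fun ω => Y n ω t)
    (hX' : ∀ t, Measurable fun ω => X' ω t) (hY' : ∀ t, Measurable fun ω => Y' ω t)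
    (hinc : ∀ n, ∀ᵐ ω ∂(μ n), IsUnboundedIncreasing (Y n ω))
    (hinc' : ∀ᵐ ω ∂μ', IsUnboundedIncreasing (Y' ω))
    (hmod : ∀ ε : ℝ≥0∞, 0 < ε → ∀ T : ℝ≥0, 0 < T →
      Tendsto (fun δ : ℝ => limsup (fun n => μ n {ω | ε < modulus gapC (fun t => X n ω t) δ T})
        atTop) (𝓝[>] 0) (𝓝 0))
    (hfdd : ∀ I : Finset ℝ≥0, (I : Set ℝ≥0) ⊆ S → TendstoInDistribution
      (fun n ω (t : I) => (X n ω t, Y n ω t)) atTop (fun ω (t : I) => (X' ω t, Y' ω t)) μ μ')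
    {ι : Type*} [Fintype ι] {t : ι → ℝ≥0} (ht : ∀ i, IsRegularTime μ' Y' S (t i))
    {g : ι → ℝ → ℝ} (hg : ∀ i x, |g i x| ≤ 1) (hg' : ∀ i, LipschitzWith 1 (g i)) :
    Tendsto (fun n => ∫ ω, ∏ i, g i (compFun (X n ω) (Y n ω) (t i)) ∂(μ n)) atTop
      (𝓝 (∫ ω, ∏ i, g i (compFun (X' ω) (Y' ω) (t i)) ∂μ')) := by
  classical
  rw [Metric.tendsto_nhds]
  intro ε hε
  set k : ℝ := (Fintype.card ι : ℝ) with hk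
  have hk0 : 0 ≤ k := Nat.cast_nonneg _
  -- `c` serves as oscillation bound and as probability bound. The budget is two comparison errors
  -- plus `c` for the finite-dimensional approximations.
  obtain ⟨c, hc, hcε⟩ : ∃ c : ℝ, 0 < c ∧ 2 * (k * c + 2 * ((k + 2) * c)) + c < ε := by
    refine ⟨ε / (2 * (2 * (k + 2 * (k + 2)) + 1)), by positivity, ?_⟩
    have h : 0 < 2 * (k + 2 * (k + 2)) + 1 := by positivity
    have : 2 * (k * (ε / (2 * (2 * (k + 2 * (k + 2)) + 1))) +
        2 * ((k + 2) * (ε / (2 * (2 * (k + 2 * (k + 2)) + 1)))))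
        + ε / (2 * (2 * (k + 2 * (k + 2)) + 1)) = ε / 2 := by
      field_simp
    linarith
  have hc' : 0 < ENNReal.ofReal c := ENNReal.ofReal_pos.2 hc
  obtain ⟨B, hB⟩ : ∃ B : ℝ≥0, ∀ i, t i + 1 < B := by
    refine ⟨∑ i, (t i + 1) + 1, fun i => lt_of_le_of_lt ?_ (lt_add_one _)⟩
    exact Finset.single_le_sum (f := fun i => t i + 1) (fun _ _ => bot_le) (Finset.mem_univ i)
  obtain ⟨r, hrS, hBr, -⟩ := hS.exists_between (lt_add_one B)
  obtain ⟨M, hM', hM⟩ := exists_nat_measure_lt (tendstoInDistribution_fst_snd hfdd hrS).2 hc'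
  obtain ⟨δ, hδ, hosc⟩ := exists_eventually_measure_not_oscLe_le hmod hc
    (T := (M : ℝ≥0) + 1) (by positivity) hc'
  have hosc' := measure_not_oscLe_le hS hfdd hosc
  obtain ⟨η, hη, rfl⟩ : ∃ η : ℝ, 0 < η ∧ δ = 2 * η := ⟨δ / 2, half_pos hδ, by ring⟩
  obtain ⟨I, hIS, hIM, hI⟩ := exists_isGrid hS hη (M : ℝ≥0)
  -- By Markov's inequality a mean increment below `η * c` exceeds `η` with probability at most `c`.
  choose s hsS s' hs'S hst hts hs't hreg using fun i => ht i M (η * c) (by positivity)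
  have hs'r : ∀ i, s' i ≤ r := fun i => ((hs't i).trans (hB i).le).trans hBr.le
  have hM0 : (0 : ℝ) ≤ M := Nat.cast_nonneg _
  -- convergence of the increments of the clipped `Yₙ`
  have hclip : ∀ᶠ n in atTop, ∀ i,
      μ n {ω | η ≤ clip M (Y n ω (s' i)) - clip M (Y n ω (s i))} ≤ ENNReal.ofReal c := by
    refine eventually_all.2 fun i => ?_
    have h := hfdd {s i, s' i} (by
      intro u hu
      simp only [Finset.coe_insert, Finset.coe_singleton, mem_insert_iff, mem_singleton_iff] at hu
      rcases hu with rfl | rfl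
      exacts [hsS i, hs'S i])
    let j : ({s i, s' i} : Finset ℝ≥0) := ⟨s i, by simp⟩
    let j' : ({s i, s' i} : Finset ℝ≥0) := ⟨s' i, by simp⟩
    have h1 := tendsto_integral_of_tendstoInDistribution h
      (F := fun v => clip M (v j').2 - clip M (v j).2) (by fun_prop) (C := M + M) fun v =>
      (abs_sub _ _).trans (add_le_add (abs_clip_le hM0 _) (abs_clip_le hM0 _))
    filter_upwards [h1.eventually (gt_mem_nhds (hreg i))] with n hn
    exact measure_clip_sub_le (hY n) (hinc n) hM0 hη ((hst i).trans (hts i)) hn.le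
  have hclip' : ∀ i, μ' {ω | η ≤ clip M (Y' ω (s' i)) - clip M (Y' ω (s i))}
      ≤ ENNReal.ofReal c := fun i =>
    measure_clip_sub_le hY' hinc' hM0 hη ((hst i).trans (hts i)) (hreg i).le
  have happ := abs_integral_prod_compFun_sub_le hX' hY' hinc' hc.le hc.le hst hts hs'r hg hg' hIM hI
    hM'.le hosc' hclip'
  -- convergence of the expectations of the finite-dimensional approximations
  have hfin : Tendsto (fun n => ∫ ω, ∏ i, g i (interp I η M (X n ω) (Y n ω (s i))) ∂(μ n)) atTop
      (𝓝 (∫ ω, ∏ i, g i (interp I η M (X' ω) (Y' ω (s i))) ∂μ')) := by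
    -- Grid points for `X` and times `s i` for `Y` are read from one joint vector.
    let J : Finset ℝ≥0 := I ∪ Finset.univ.image s
    have hJ : (J : Set ℝ≥0) ⊆ S := by
      intro u hu
      rcases Finset.mem_union.1 (Finset.mem_coe.1 hu) with h | h
      · exact hIS h
      · obtain ⟨i, -, rfl⟩ := Finset.mem_image.1 h
        exact hsS i
    have hsJ : ∀ i, s i ∈ J := fun i =>
      Finset.mem_union_right _ (Finset.mem_image_of_mem _ (Finset.mem_univ i))
    let F : (J → ℝ × ℝ) → ℝ := fun v =>
      ∏ i, g i (interp I η M (fun u => if h : u ∈ J then (v ⟨u, h⟩).1 else 0) (v ⟨s i, hsJ i⟩).2)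
    have hF : Continuous F := by
      refine continuous_finsetProd _ fun i _ => (hg' i).continuous.comp ?_
      refine hI.continuous_interp M.cast_nonneg (fun u hu => ?_) (by fun_prop)
      have : u ∈ J := Finset.mem_union_left _ hu
      simp only [this, dite_true]
      fun_prop
    have hF1 : ∀ v, |F v| ≤ 1 := fun v => by
      rw [Finset.abs_prod]
      exact Finset.prod_le_one (fun _ _ => abs_nonneg _) fun i _ => hg i _
    have hFeq : ∀ x y : CadlagPath, F (fun u => (x u, y u)) =
        ∏ i, g i (interp I η M x (y (s i))) := by
      intro x y
      refine Finset.prod_congr rfl fun i _ => ?_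
      simp only [interp]
      congr 2
      refine Finset.sum_congr rfl fun u hu => ?_
      have : u ∈ J := Finset.mem_union_left _ hu
      simp [this]
    have := tendsto_integral_of_tendstoInDistribution (hfdd J hJ) hF hF1
    simpa only [hFeq] using this
  filter_upwards [hM, hosc, hclip, hfin.eventually (Metric.ball_mem_nhds _ hc)]
    with n h1 h2 h3 h4
  have h5 := abs_integral_prod_compFun_sub_le (hX n) (hY n) (hinc n) hc.le hc.le hst hts hs'r hg hg'
    hIM hI h1.le h2 h3
  rw [Real.dist_eq] at h4 ⊢
  rw [abs_sub_comm] at happ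
  have h6 := abs_sub_le (∫ ω, ∏ i, g i (compFun (X n ω) (Y n ω) (t i)) ∂(μ n))
    (∫ ω, ∏ i, g i (interp I η M (X n ω) (Y n ω (s i))) ∂(μ n))
    (∫ ω, ∏ i, g i (compFun (X' ω) (Y' ω) (t i)) ∂μ')
  have h7 := abs_sub_le (∫ ω, ∏ i, g i (interp I η M (X n ω) (Y n ω (s i))) ∂(μ n))
    (∫ ω, ∏ i, g i (interp I η M (X' ω) (Y' ω (s i))) ∂μ')
    (∫ ω, ∏ i, g i (compFun (X' ω) (Y' ω) (t i)) ∂μ')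
  simp only [NNReal.coe_natCast] at happ h5
  linarith

end Sequence

/-! ### Saturated paths in the weakly compact ball of `L²` -/

/-- The map `x ↦ x / c`, saturated at `±1`. -/
noncomputable def sat (c x : ℝ) : ℝ := max (-1) (min (x / c) 1)

theorem abs_sat_le (c x : ℝ) : |sat c x| ≤ 1 :=
  abs_le.2 ⟨le_max_left _ _, max_le (by norm_num) (min_le_right _ _)⟩

/-- Division by `c ≥ 1` is nonexpansive, and so is clamping. The `+ 1` in `level` secures this lower
bound. -/
theorem lipschitzWith_sat {c : ℝ} (hc : 1 ≤ c) : LipschitzWith 1 (sat c) := by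
  have h : LipschitzWith 1 fun x : ℝ => x / c := by
    refine LipschitzWith.of_dist_le_mul fun x y => ?_
    rw [Real.dist_eq, Real.dist_eq, ← sub_div, abs_div, abs_of_pos (by linarith : 0 < c),
      NNReal.coe_one, one_mul]
    exact div_le_self (abs_nonneg _) hc
  exact (h.min_const 1).const_max (-1)

theorem sat_of_abs_le {c x : ℝ} (hc : 0 < c) (hx : |x| ≤ c) : sat c x = x / c := by
  obtain ⟨h1, h2⟩ := abs_le.1 hx
  rw [sat, min_eq_left ((div_le_one hc).2 h2), max_eq_right ((le_div_iff₀ hc).2 (by linarith))]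

/-- The step function with value `C k + 1` on `[k, k + 1)`. -/
noncomputable def level (C : ℕ → ℕ) (t : ℝ≥0) : ℝ := C ⌊t⌋₊ + 1

theorem one_le_level (C : ℕ → ℕ) (t : ℝ≥0) : 1 ≤ level C t := by
  simp [level]

theorem measurable_level (C : ℕ → ℕ) : Measurable (level C) := by
  have h : Measurable fun k : ℕ => (C k : ℝ) + 1 := measurable_from_top
  exact h.comp Nat.measurable_floor

theorem exists_level_le (C : ℕ → ℕ) (T : ℝ≥0) : ∃ B : ℝ, ∀ t ≤ T, level C t ≤ B := by
  refine ⟨((Finset.range (⌊T⌋₊ + 1)).sup C : ℕ) + 1, fun t ht => ?_⟩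
  have : C ⌊t⌋₊ ≤ (Finset.range (⌊T⌋₊ + 1)).sup C :=
    Finset.le_sup (Finset.mem_range.2 (Nat.lt_succ_of_le (Nat.floor_le_floor ht)))
  rw [level]
  gcongr

/-- The saturation of the path `z` at the levels `level C`, damped by `e^{-t}`. -/
noncomputable def damp (C : ℕ → ℕ) (z : ℝ≥0 → ℝ) (t : ℝ≥0) : ℝ :=
  Real.exp (-t) * sat (level C t) (z t)

theorem measurable_uncurry_sat (C : ℕ → ℕ) {A : Type*} [MeasurableSpace A] {z : A → ℝ≥0 → ℝ}
    (hz : Measurable fun p : A × ℝ≥0 => z p.1 p.2) :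
    Measurable fun p : A × ℝ≥0 => sat (level C p.2) (z p.1 p.2) :=
  measurable_const.max ((hz.div ((measurable_level C).comp measurable_snd)).min measurable_const)

theorem measurable_damp (C : ℕ → ℕ) {z : ℝ≥0 → ℝ} (hz : Measurable z) : Measurable (damp C z) := by
  have h : Measurable fun t : ℝ≥0 => sat (level C t) (z t) :=
    measurable_const.max ((hz.div (measurable_level C)).min measurable_const)
  exact Measurable.mul (by fun_prop) h

theorem abs_damp_le (C : ℕ → ℕ) (z : ℝ≥0 → ℝ) (t : ℝ≥0) : |damp C z t| ≤ Real.exp (-t) := by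
  rw [damp, abs_mul, abs_of_pos (Real.exp_pos _)]
  exact mul_le_of_le_one_right (Real.exp_pos _).le (abs_sat_le _ _)

theorem memLp_damp (C : ℕ → ℕ) {z : ℝ≥0 → ℝ} (hz : Measurable z) :
    MemLp (damp C z) 2 lebesgue :=
  memLp_exp_neg.mono (measurable_damp C hz).aestronglyMeasurable
    (Eventually.of_forall fun t => by
      rw [Real.norm_eq_abs, Real.norm_of_nonneg (Real.exp_pos _).le]
      exact abs_damp_le C z t)

/-- The dominating function `e^{-t}` depends neither on the path nor on the levels: one ball serves
all. -/
theorem norm_toLp_damp_le (C : ℕ → ℕ) {z : ℝ≥0 → ℝ} (hz : Measurable z) :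
    ‖(memLp_damp C hz).toLp‖ ≤ ‖memLp_exp_neg.toLp‖ := by
  refine Lp.norm_le_norm_of_ae_le ?_
  filter_upwards [(memLp_damp C hz).coeFn_toLp, memLp_exp_neg.coeFn_toLp] with t h1 h2
  rw [h1, h2, Real.norm_eq_abs, Real.norm_of_nonneg (Real.exp_pos _).le]
  exact abs_damp_le C z t

theorem measurable_level_mul_exp (C : ℕ → ℕ) :
    Measurable fun t : ℝ≥0 => level C t * Real.exp t :=
  (measurable_level C).mul (by fun_prop)

theorem memLp_level_mul (C : ℕ → ℕ) (T : ℝ≥0) {f : ℝ≥0 → ℝ}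
    (hf : MemLp f 2 (lebesgue.restrict (Iic T))) :
    MemLp (fun t : ℝ≥0 => level C t * Real.exp t * f t) 2 (lebesgue.restrict (Iic T)) := by
  obtain ⟨B, hB⟩ := exists_level_le C T
  refine hf.of_le_mul (c := B * Real.exp T)
    ((measurable_level_mul_exp C).aestronglyMeasurable.mul hf.1) ?_
  refine (ae_restrict_iff' measurableSet_Iic).2 (Eventually.of_forall fun t ht => ?_)
  have h0 : 0 < level C t := one_pos.trans_le (one_le_level C t)
  rw [norm_mul, norm_mul, Real.norm_of_nonneg h0.le, Real.norm_of_nonneg (Real.exp_pos _).le]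
  have hB0 : 0 ≤ B := h0.le.trans (hB t ht)
  gcongr
  · exact hB t ht
  · exact ht

/-- The inverse of damping, as a map from `L²` to `𝓛²_loc`. -/
noncomputable def expand (C : ℕ → ℕ) (h : Lp ℝ 2 lebesgue) : L2loc :=
  L2loc.mk (fun t => level C t * Real.exp t * h t)
    ((measurable_level_mul_exp C).mul (Lp.stronglyMeasurable h).measurable)
    fun T => memLp_level_mul C T ((Lp.memLp h).restrict _)

theorem memLp_indicator_level_mul (C : ℕ → ℕ) (T : ℝ≥0) {f : ℝ≥0 → ℝ}
    (hf : MemLp f 2 (lebesgue.restrict (Iic T))) :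
    MemLp ((Iic T).indicator fun t : ℝ≥0 => level C t * Real.exp t * f t) 2 lebesgue :=
  (memLp_indicator_iff_restrict measurableSet_Iic).2 (memLp_level_mul C T hf)

/-- Weight and cut-off move onto the test function, where the weight is bounded on `[0, T]`. The
pairing thus becomes a weakly continuous functional of `h`. -/
theorem expand_pairing (C : ℕ → ℕ) (h : Lp ℝ 2 lebesgue) (T : ℝ≥0) {f : ℝ≥0 → ℝ}
    (hf : MemLp f 2 (lebesgue.restrict (Iic T))) :
    (expand C h).pairing T f = inner ℝ h (memLp_indicator_level_mul C T hf).toLp := by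
  rw [expand, L2loc.mk_pairing, L2.inner_def, ← integral_indicator (s := Iic T) measurableSet_Iic]
  refine integral_congr_ae ?_
  filter_upwards [(memLp_indicator_level_mul C T hf).coeFn_toLp] with t ht
  rw [ht]
  by_cases h' : t ∈ Iic T
  · simp only [indicator_of_mem h', RCLike.inner_apply, conj_trivial]
    ring
  · simp [h']

/-- Taking `k = ⌊t⌋₊` in the bound shows that saturation is inactive at `t`, and a pure scaling is
undone exactly. -/
theorem expand_damp (C : ℕ → ℕ) {x y : CadlagPath}
    (h : ∀ k : ℕ, ∀ t : ℝ≥0, t < k + 1 → |compFun x y t| ≤ C k) :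
    expand C (memLp_damp C (compFun_measurable x y)).toLp = comp x y := by
  refine Subtype.ext (AEEqFun.mk_eq_mk.2 ?_)
  filter_upwards [(memLp_damp C (compFun_measurable x y)).coeFn_toLp] with t ht
  have h1 := one_le_level C t
  have h2 : |compFun x y t| ≤ level C t :=
    (h ⌊t⌋₊ t (Nat.lt_floor_add_one t)).trans (by rw [level]; linarith)
  rw [ht, damp, sat_of_abs_le (by linarith) h2, Real.exp_neg]
  have := (Real.exp_pos t).ne'
  field_simp

/-! ### The weak-* compact ball and its polynomial functions -/

/-- The weakly compact ball of `L²` that contains all damped paths. -/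
def dampBall : Set (WeakDual ℝ (Lp ℝ 2 lebesgue)) :=
  WeakDual.toStrongDual ⁻¹' Metric.closedBall 0 ‖memLp_exp_neg.toLp‖

/-- Banach–Alaoglu. -/
instance : CompactSpace dampBall :=
  isCompact_iff_compactSpace.1 (WeakDual.isCompact_closedBall _ _)

/-- A damped path, as an element of the weakly compact ball. -/
noncomputable def dampPoint (C : ℕ → ℕ) (x y : CadlagPath) : dampBall :=
  ⟨WeakDual.toStrongDual.symm
    (InnerProductSpace.toDual ℝ _ (memLp_damp C (compFun_measurable x y)).toLp), by
    simp only [dampBall, mem_preimage, LinearEquiv.apply_symm_apply, mem_closedBall_zero_iff,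
      LinearIsometryEquiv.norm_map]
    exact norm_toLp_damp_le C (compFun_measurable x y)⟩

theorem dampPoint_apply (C : ℕ → ℕ) (x y : CadlagPath) (h : Lp ℝ 2 lebesgue) :
    (dampPoint C x y).1 h = ∫ t, damp C (compFun x y) t * h t ∂lebesgue := by
  change inner ℝ (memLp_damp C (compFun_measurable x y)).toLp h = _
  rw [L2.inner_def]
  refine integral_congr_ae ?_
  filter_upwards [(memLp_damp C (compFun_measurable x y)).coeFn_toLp] with t ht
  rw [ht]
  simp [mul_comm]

/-- The inverse of damping on the weakly compact ball. -/
noncomputable def expandDual (C : ℕ → ℕ) (φ : dampBall) : L2loc :=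
  expand C ((InnerProductSpace.toDual ℝ _).symm (WeakDual.toStrongDual φ.1))

/-- Every scalar product of the image is the evaluation of the functional at a fixed vector. Test
functions on `𝓛²_w` therefore pull back to continuous functions on a compact space. -/
theorem continuous_expandDual (C : ℕ → ℕ) : Continuous (expandDual C) := by
  refine continuous_iff_continuousAt.2 fun φ => L2loc.tendsto_iff.2 fun T _ f hf => ?_
  simp only [expandDual, expand_pairing C _ T hf, InnerProductSpace.toDual_symm_apply]
  exact ((WeakDual.eval_continuous _).comp continuous_subtype_val).tendsto φ

theorem expandDual_dampPoint (C : ℕ → ℕ) {x y : CadlagPath}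
    (h : ∀ k : ℕ, ∀ t : ℝ≥0, t < k + 1 → |compFun x y t| ≤ C k) :
    expandDual C (dampPoint C x y) = comp x y := by
  rw [← expand_damp C h, expandDual, dampPoint]
  simp

/-- Evaluation at a vector, as a function on the weakly compact ball. -/
noncomputable def evalBall (h : Lp ℝ 2 lebesgue) : C(dampBall, ℝ) :=
  ⟨fun φ => φ.1 h, (WeakDual.eval_continuous h).comp continuous_subtype_val⟩

/-- The algebra of polynomials in the evaluations. -/
noncomputable def evalAlgebra : Subalgebra ℝ C(dampBall, ℝ) := Algebra.adjoin ℝ (range evalBall)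

theorem evalAlgebra_separatesPoints : evalAlgebra.SeparatesPoints := by
  intro φ ψ hne
  by_contra h
  push Not at h
  refine hne (Subtype.ext (DFunLike.ext _ _ fun x => ?_))
  exact h _ ⟨evalBall x, Algebra.subset_adjoin ⟨x, rfl⟩, rfl⟩

theorem exists_eq_prod_of_mem_closure {q : C(dampBall, ℝ)}
    (hq : q ∈ Submonoid.closure (range evalBall)) :
    ∃ (k : ℕ) (h : Fin k → Lp ℝ 2 lebesgue), ∀ φ, q φ = ∏ i, φ.1 (h i) := by
  induction hq using Submonoid.closure_induction with
  | mem q hq =>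
    obtain ⟨h, rfl⟩ := hq
    exact ⟨1, fun _ => h, fun φ => by simp [evalBall]⟩
  | one => exact ⟨0, Fin.elim0, fun φ => by simp⟩
  | mul q q' _ _ hq hq' =>
    obtain ⟨k, h, hh⟩ := hq
    obtain ⟨k', h', hh'⟩ := hq'
    refine ⟨k + k', Fin.append h h', fun φ => ?_⟩
    rw [Fin.prod_univ_add]
    simp [hh, hh']

/-! ### Moments as integrals over times -/

section Moments

variable {Ω : Type*} [MeasurableSpace Ω] {P : Measure Ω} [IsProbabilityMeasure P]
  {X Y : Ω → CadlagPath}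

theorem measurable_dampPoint_apply (C : ℕ → ℕ) (hX : ∀ t, Measurable fun ω => X ω t)
    (hY : ∀ t, Measurable fun ω => Y ω t) (h : Lp ℝ 2 lebesgue) :
    Measurable fun ω => (dampPoint C (X ω) (Y ω)).1 h := by
  simp only [dampPoint_apply]
  have hs := measurable_uncurry_sat C (z := fun ω => compFun (X ω) (Y ω))
    (measurable_uncurry_compFun hX hY)
  have hm : StronglyMeasurable fun p : Ω × ℝ≥0 =>
      damp C (compFun (X p.1) (Y p.1)) p.2 * h p.2 := by
    refine Measurable.stronglyMeasurable (Measurable.mul (Measurable.mul ?_ hs)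
      ((Lp.stronglyMeasurable h).measurable.comp measurable_snd))
    exact Measurable.comp (g := fun t : ℝ≥0 => Real.exp (-t)) (by fun_prop) measurable_snd
  exact hm.integral_prod_right.measurable

theorem integrable_exp_neg_mul (h : Lp ℝ 2 lebesgue) :
    Integrable (fun t : ℝ≥0 => Real.exp (-t) * h t) lebesgue :=
  memLp_exp_neg.integrable_mul (Lp.memLp h)

theorem integrable_continuousMap_comp {b : Ω → dampBall} (q : C(dampBall, ℝ))
    (hm : Measurable fun ω => q (b ω)) : Integrable (fun ω => q (b ω)) P :=
  Integrable.of_bound hm.aestronglyMeasurable ‖q‖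
    (Eventually.of_forall fun _ => q.norm_coe_le_norm _)

/-- If the paths exceed the levels `C` with small probability only, expectations of a function on
`𝓛²_loc` are close to those of its uniform approximation on the weakly compact ball. -/
theorem abs_integral_comp_sub_le (hX : ∀ t, Measurable fun ω => X ω t)
    (hY : ∀ t, Measurable fun ω => Y ω t) (Φ : BoundedContinuousFunction L2loc ℝ) {C : ℕ → ℕ}
    {q : C(dampBall, ℝ)} (hm : Measurable fun ω => q (dampPoint C (X ω) (Y ω))) {ε : ℝ} (hε : 0 ≤ ε)
    (hq : ∀ φ, |q φ - Φ (expandDual C φ)| ≤ ε) {c : ℕ → ℝ≥0} {b : ℝ}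
    (hcb : ∑' k, (c k : ℝ≥0∞) ≤ ENNReal.ofReal b) (hb : 0 ≤ b)
    (hC : ∀ k : ℕ, P {ω | ∃ t < (k : ℝ≥0) + 1, (C k : ℝ) < |compFun (X ω) (Y ω) t|} ≤ c k) :
    |∫ ω, Φ (comp (X ω) (Y ω)) ∂P - ∫ ω, q (dampPoint C (X ω) (Y ω)) ∂P|
      ≤ ε + 2 * (‖Φ‖ + ε) * b := by
  -- The exceptional event is the union over `k` of the exceedances of `C k`. Off it `expandDual`
  -- recovers the composition exactly.
  refine abs_integral_sub_le
    (Φ.continuous.measurable.comp (measurable_comp hX hY)).aestronglyMeasurable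
    hm.aestronglyMeasurable hε hb (fun ω => ?_) (fun ω => ?_)
    (((measure_iUnion_le _).trans (ENNReal.tsum_le_tsum hC)).trans hcb) fun ω hω => ?_
  · exact (Φ.norm_coe_le_norm _).trans (by linarith)
  · have h1 := hq (dampPoint C (X ω) (Y ω))
    have h2 := abs_sub_abs_le_abs_sub (q (dampPoint C (X ω) (Y ω)))
      (Φ (expandDual C (dampPoint C (X ω) (Y ω))))
    have h3 : |Φ (expandDual C (dampPoint C (X ω) (Y ω)))| ≤ ‖Φ‖ := Φ.norm_coe_le_norm _
    linarith
  · simp only [mem_iUnion, mem_ofPred_eq, not_exists, not_and, not_lt] at hω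
    change |Φ (comp (X ω) (Y ω)) - _| ≤ ε
    rw [← expandDual_dampPoint C hω, abs_sub_comm]
    exact hq _

/-- Moments of the scalar products in terms of the finite-dimensional distributions. -/
theorem integral_prod_dampPoint (C : ℕ → ℕ) (hX : ∀ t, Measurable fun ω => X ω t)
    (hY : ∀ t, Measurable fun ω => Y ω t) {k : ℕ} (h : Fin k → Lp ℝ 2 lebesgue) :
    ∫ ω, ∏ i, (dampPoint C (X ω) (Y ω)).1 (h i) ∂P =
      ∫ t : Fin k → ℝ≥0, (∏ i, Real.exp (-(t i)) * h i (t i)) *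
        ∫ ω, ∏ i, sat (level C (t i)) (compFun (X ω) (Y ω) (t i)) ∂P
        ∂(Measure.pi fun _ => lebesgue) := by
  have hs := measurable_uncurry_sat C (z := fun ω => compFun (X ω) (Y ω))
    (measurable_uncurry_compFun hX hY)
  have hprod : Integrable (fun t : Fin k → ℝ≥0 => ∏ i, Real.exp (-(t i)) * h i (t i))
      (Measure.pi fun _ => lebesgue) :=
    Integrable.fintype_prod fun i => integrable_exp_neg_mul (h i)
  have hint : Integrable (Function.uncurry fun (ω : Ω) (t : Fin k → ℝ≥0) =>
      (∏ i, Real.exp (-(t i)) * h i (t i)) *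
        ∏ i, sat (level C (t i)) (compFun (X ω) (Y ω) (t i)))
      (P.prod (Measure.pi fun _ => lebesgue)) := by
    refine (hprod.comp_snd P).mul_bdd (c := 1) ?_ (Eventually.of_forall fun p => ?_)
    · refine (Finset.measurable_fun_prod _ fun i _ => ?_).aestronglyMeasurable
      exact hs.comp (measurable_fst.prodMk ((measurable_pi_apply i).comp measurable_snd))
    · rw [Real.norm_eq_abs, Finset.abs_prod]
      exact Finset.prod_le_one (fun _ _ => abs_nonneg _) fun i _ => abs_sat_le _ _
  calc ∫ ω, ∏ i, (dampPoint C (X ω) (Y ω)).1 (h i) ∂P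
      = ∫ ω, ∫ t : Fin k → ℝ≥0, (∏ i, Real.exp (-(t i)) * h i (t i)) *
        ∏ i, sat (level C (t i)) (compFun (X ω) (Y ω) (t i))
          ∂(Measure.pi fun _ => lebesgue) ∂P := by
        refine integral_congr_ae (Eventually.of_forall fun ω => ?_)
        simp only [dampPoint_apply]
        -- A product of time integrals is an integral over `k`-tuples of times, after which time and
        -- `ω` are interchanged.
        rw [← integral_fintype_prod_eq_prod
          (f := fun i t => damp C (compFun (X ω) (Y ω)) t * h i t)]
        refine integral_congr_ae (Eventually.of_forall fun t => ?_)
        simp only [damp, ← Finset.prod_mul_distrib]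
        exact Finset.prod_congr rfl fun i _ => by ring
    _ = _ := by
        rw [integral_integral_swap hint]
        simp only [integral_const_mul]

end Moments

/-! ### From moments to weak convergence -/

section Main

variable {Ω : ℕ → Type*} {Ω' : Type*} [∀ n, MeasurableSpace (Ω n)] [MeasurableSpace Ω']
  {μ : (n : ℕ) → Measure (Ω n)} [∀ n, IsProbabilityMeasure (μ n)]
  {μ' : Measure Ω'} [IsProbabilityMeasure μ']
  {X Y : (n : ℕ) → Ω n → CadlagPath} {X' Y' : Ω' → CadlagPath}

/-- Dominated convergence over tuples of times. Almost every tuple has all coordinates in `G`; there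
the saturations are fixed bounded 1-Lipschitz functions, and `∏ e^{-tᵢ} |hᵢ|` dominates. -/
theorem tendsto_integral_prod_dampPoint (C : ℕ → ℕ)
    (hX : ∀ n t, Measurable fun ω => X n ω t) (hY : ∀ n t, Measurable fun ω => Y n ω t)
    (hX' : ∀ t, Measurable fun ω => X' ω t) (hY' : ∀ t, Measurable fun ω => Y' ω t)
    {G : Set ℝ≥0} (hG : ∀ᵐ t ∂lebesgue, t ∈ G)
    (hconv : ∀ (k : ℕ) (t : Fin k → ℝ≥0), (∀ i, t i ∈ G) → ∀ g : Fin k → ℝ → ℝ,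
      (∀ i x, |g i x| ≤ 1) → (∀ i, LipschitzWith 1 (g i)) →
      Tendsto (fun n => ∫ ω, ∏ i, g i (compFun (X n ω) (Y n ω) (t i)) ∂(μ n)) atTop
        (𝓝 (∫ ω, ∏ i, g i (compFun (X' ω) (Y' ω) (t i)) ∂μ')))
    {k : ℕ} (h : Fin k → Lp ℝ 2 lebesgue) :
    Tendsto (fun n => ∫ ω, ∏ i, (dampPoint C (X n ω) (Y n ω)).1 (h i) ∂(μ n)) atTop
      (𝓝 (∫ ω, ∏ i, (dampPoint C (X' ω) (Y' ω)).1 (h i) ∂μ')) := by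
  simp only [integral_prod_dampPoint C hX' hY' h]
  simp only [fun n => integral_prod_dampPoint (P := μ n) C (hX n) (hY n) h]
  have hprod : Integrable (fun t : Fin k → ℝ≥0 => ∏ i, Real.exp (-(t i)) * h i (t i))
      (Measure.pi fun _ => lebesgue) :=
    Integrable.fintype_prod fun i => integrable_exp_neg_mul (h i)
  refine tendsto_integral_of_dominated_convergence _ (fun n => hprod.1.mul ?_) hprod.norm
    (fun n => Eventually.of_forall fun t => ?_) ?_
  · have hs := measurable_uncurry_sat C (z := fun ω => compFun (X n ω) (Y n ω))
      (measurable_uncurry_compFun (hX n) (hY n))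
    have hm : StronglyMeasurable fun p : (Fin k → ℝ≥0) × Ω n =>
        ∏ i, sat (level C (p.1 i)) (compFun (X n p.2) (Y n p.2) (p.1 i)) := by
      refine (Finset.measurable_fun_prod _ fun i _ => ?_).stronglyMeasurable
      exact hs.comp (measurable_snd.prodMk ((measurable_pi_apply i).comp measurable_fst))
    exact hm.integral_prod_right.aestronglyMeasurable
  · rw [norm_mul]
    refine mul_le_of_le_one_right (norm_nonneg _) ?_
    refine (norm_integral_le_of_norm_le_const (C := 1) (Eventually.of_forall fun ω => ?_)).trans
      (by simp)
    rw [Real.norm_eq_abs, Finset.abs_prod]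
    exact Finset.prod_le_one (fun _ _ => abs_nonneg _) fun i _ => abs_sat_le _ _
  · have hae : ∀ᵐ t : Fin k → ℝ≥0 ∂(Measure.pi fun _ => lebesgue), ∀ i, t i ∈ G :=
      eventually_all.2 fun i => Measure.tendsto_eval_ae_ae.eventually hG
    filter_upwards [hae] with t ht
    exact (hconv k t ht (fun i => sat (level C (t i))) (fun _ _ => abs_sat_le _ _)
      fun i => lipschitzWith_sat (one_le_level C _)).const_mul _

/-- Linearity reduces the claim to monomials. Measurability is carried through the induction because
additivity of the integral requires it. -/
theorem tendsto_integral_evalAlgebra (C : ℕ → ℕ)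
    (hX : ∀ n t, Measurable fun ω => X n ω t) (hY : ∀ n t, Measurable fun ω => Y n ω t)
    (hX' : ∀ t, Measurable fun ω => X' ω t) (hY' : ∀ t, Measurable fun ω => Y' ω t)
    {G : Set ℝ≥0} (hG : ∀ᵐ t ∂lebesgue, t ∈ G)
    (hconv : ∀ (k : ℕ) (t : Fin k → ℝ≥0), (∀ i, t i ∈ G) → ∀ g : Fin k → ℝ → ℝ,
      (∀ i x, |g i x| ≤ 1) → (∀ i, LipschitzWith 1 (g i)) →
      Tendsto (fun n => ∫ ω, ∏ i, g i (compFun (X n ω) (Y n ω) (t i)) ∂(μ n)) atTop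
        (𝓝 (∫ ω, ∏ i, g i (compFun (X' ω) (Y' ω) (t i)) ∂μ')))
    {q : C(dampBall, ℝ)} (hq : q ∈ evalAlgebra) :
    (∀ n, Measurable fun ω => q (dampPoint C (X n ω) (Y n ω))) ∧
    (Measurable fun ω => q (dampPoint C (X' ω) (Y' ω))) ∧
    Tendsto (fun n => ∫ ω, q (dampPoint C (X n ω) (Y n ω)) ∂(μ n)) atTop
      (𝓝 (∫ ω, q (dampPoint C (X' ω) (Y' ω)) ∂μ')) := by
  have hspan : q ∈ Submodule.span ℝ (Submonoid.closure (range evalBall) : Set C(dampBall, ℝ)) := by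
    rw [← Algebra.adjoin_eq_span]
    exact hq
  clear hq
  induction hspan using Submodule.span_induction with
  | mem q hq =>
    obtain ⟨k, h, hh⟩ := exists_eq_prod_of_mem_closure hq
    simp only [hh]
    exact ⟨fun n => Finset.measurable_fun_prod _ fun i _ =>
        measurable_dampPoint_apply C (hX n) (hY n) _,
      Finset.measurable_fun_prod _ fun i _ => measurable_dampPoint_apply C hX' hY' _,
      tendsto_integral_prod_dampPoint C hX hY hX' hY' hG hconv h⟩
  | zero => exact ⟨fun n => measurable_const, measurable_const, by simp⟩
  | add p q _ _ hp hq =>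
    obtain ⟨hp1, hp2, hp3⟩ := hp
    obtain ⟨hq1, hq2, hq3⟩ := hq
    simp only [ContinuousMap.add_apply]
    refine ⟨fun n => (hp1 n).add (hq1 n), hp2.add hq2, ?_⟩
    rw [integral_add (integrable_continuousMap_comp p hp2) (integrable_continuousMap_comp q hq2)]
    simp only [fun n => integral_add (integrable_continuousMap_comp (P := μ n) p (hp1 n))
      (integrable_continuousMap_comp (P := μ n) q (hq1 n))]
    exact hp3.add hq3
  | smul a q _ hq =>
    obtain ⟨hq1, hq2, hq3⟩ := hq
    simp only [ContinuousMap.smul_apply, smul_eq_mul, integral_const_mul]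
    exact ⟨fun n => (hq1 n).const_mul a, hq2.const_mul a, hq3.const_mul a⟩

/-- Uniform boundedness in probability on bounded time sets and convergence of the
finite-dimensional distributions at almost all times imply weak convergence in `𝓛²_w`. -/
theorem tendstoL2w_of_tendsto_integral_prod
    (hX : ∀ n t, Measurable fun ω => X n ω t) (hY : ∀ n t, Measurable fun ω => Y n ω t)
    (hX' : ∀ t, Measurable fun ω => X' ω t) (hY' : ∀ t, Measurable fun ω => Y' ω t)
    {G : Set ℝ≥0} (hG : ∀ᵐ t ∂lebesgue, t ∈ G)
    (hconv : ∀ (k : ℕ) (t : Fin k → ℝ≥0), (∀ i, t i ∈ G) → ∀ g : Fin k → ℝ → ℝ,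
      (∀ i x, |g i x| ≤ 1) → (∀ i, LipschitzWith 1 (g i)) →
      Tendsto (fun n => ∫ ω, ∏ i, g i (compFun (X n ω) (Y n ω) (t i)) ∂(μ n)) atTop
        (𝓝 (∫ ω, ∏ i, g i (compFun (X' ω) (Y' ω) (t i)) ∂μ')))
    (hbdd : ∀ (T : ℝ≥0) (c : ℝ≥0∞), 0 < c →
      ∃ C : ℕ, (∀ n, μ n {ω | ∃ t < T, (C : ℝ) < |compFun (X n ω) (Y n ω) t|} ≤ c) ∧
        μ' {ω | ∃ t < T, (C : ℝ) < |compFun (X' ω) (Y' ω) t|} ≤ c) :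
    TendstoL2w (fun n ω => comp (X n ω) (Y n ω)) (fun ω => comp (X' ω) (Y' ω)) μ μ' := by
  have hm := fun n => measurable_comp (hX n) (hY n)
  have hm' := measurable_comp hX' hY'
  refine ⟨fun n => (hm n).aemeasurable, hm'.aemeasurable,
    ProbabilityMeasure.tendsto_iff_forall_integral_tendsto.2 fun Φ => ?_⟩
  simp only [ProbabilityMeasure.coe_mk]
  rw [integral_map hm'.aemeasurable Φ.continuous.measurable.aestronglyMeasurable]
  simp only [fun n => integral_map (hm n).aemeasurable
    (Φ.continuous.measurable.aestronglyMeasurable (μ := (μ n).map fun ω => comp (X n ω) (Y n ω)))]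
  rw [Metric.tendsto_nhds]
  intro ε hε
  -- Each of the two comparisons costs `ε / 8` for the approximation and `ε / 8` for the exceptional
  -- event; `ε / 2` is left for the convergence of the polynomial.
  obtain ⟨b, hb, hbε⟩ : ∃ b : ℝ, 0 < b ∧ 2 * (‖Φ‖ + ε / 8) * b ≤ ε / 8 := by
    have : 0 < ‖Φ‖ + ε / 8 := by positivity
    exact ⟨ε / 8 / (2 * (‖Φ‖ + ε / 8)), by positivity, by field_simp; rfl⟩
  obtain ⟨c, hc, hcb⟩ := ENNReal.exists_pos_sum_of_countable
    (ENNReal.ofReal_pos.2 hb).ne' ℕ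
  choose C hC hC' using fun k : ℕ => hbdd (k + 1) (c k) (ENNReal.coe_pos.2 (hc k))
  -- Stone–Weierstrass on the compact ball. The levels `C` are fixed beforehand, since the
  -- pulled-back function depends on them.
  obtain ⟨⟨q, hq⟩, hqΦ⟩ :=
    ContinuousMap.exists_mem_subalgebra_near_continuousMap_of_separatesPoints evalAlgebra
      evalAlgebra_separatesPoints ⟨_, Φ.continuous.comp (continuous_expandDual C)⟩ (ε / 8)
      (by positivity)
  have hqΦ' : ∀ φ, |q φ - Φ (expandDual C φ)| ≤ ε / 8 := fun φ =>
    ((ContinuousMap.norm_coe_le_norm _ φ).trans hqΦ.le)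
  obtain ⟨hq1, hq2, hq3⟩ := tendsto_integral_evalAlgebra C hX hY hX' hY' hG hconv hq
  have happ := abs_integral_comp_sub_le hX' hY' Φ hq2 (by positivity) hqΦ' hcb.le hb.le hC'
  filter_upwards [hq3.eventually (Metric.ball_mem_nhds _ (half_pos hε))] with n hn
  have happn := abs_integral_comp_sub_le (hX n) (hY n) Φ (hq1 n) (by positivity) hqΦ' hcb.le hb.le
    fun k => hC k n
  rw [Real.dist_eq] at hn ⊢
  rw [abs_sub_comm] at happ
  have h1 := abs_sub_le (∫ ω, Φ (comp (X n ω) (Y n ω)) ∂(μ n))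
    (∫ ω, q (dampPoint C (X n ω) (Y n ω)) ∂(μ n)) (∫ ω, Φ (comp (X' ω) (Y' ω)) ∂μ')
  have h2 := abs_sub_le (∫ ω, q (dampPoint C (X n ω) (Y n ω)) ∂(μ n))
    (∫ ω, q (dampPoint C (X' ω) (Y' ω)) ∂μ') (∫ ω, Φ (comp (X' ω) (Y' ω)) ∂μ')
  linarith

end Main

end CadlagComp

theorem theorem2p2 {Ω : ℕ → Type*} {Ω' : Type*} [∀ n, MeasurableSpace (Ω n)] [MeasurableSpace Ω']
    (μ : (n : ℕ) → Measure (Ω n)) [∀ n, IsProbabilityMeasure (μ n)]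
    (μ' : Measure Ω') [IsProbabilityMeasure μ']
    (X Y : (n : ℕ) → Ω n → CadlagComp.CadlagPath) (X' Y' : Ω' → CadlagComp.CadlagPath)
    (hX : ∀ n t, Measurable (fun ω => X n ω t)) (hY : ∀ n t, Measurable (fun ω => Y n ω t))
    (hX' : ∀ t, Measurable (fun ω => X' ω t)) (hY' : ∀ t, Measurable (fun ω => Y' ω t))
    (hYinc : ∀ n, ∀ᵐ ω ∂(μ n), CadlagComp.IsUnboundedIncreasing (Y n ω))
    (hYinc' : ∀ᵐ ω ∂μ', CadlagComp.IsUnboundedIncreasing (Y' ω))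
    (hXC : CadlagComp.TendstoC (fun n ω t => X n ω t) (fun ω t => X' ω t) μ μ')
    (hXY : CadlagComp.TendstoFDD (fun n ω t => (X n ω t, Y n ω t))
      (fun ω t => (X' ω t, Y' ω t)) μ μ')
    (hab :
      (CadlagComp.TendstoM1 (fun n ω t => Y n ω t) (fun ω t => Y' ω t) μ μ' ∧
        ∀ n, ∀ᵐ ω ∂(μ n), CadlagComp.inverse (Y n ω) 0 = 0) ∨
      (CadlagComp.TendstoM1 (fun n ω s => (CadlagComp.inverse (Y n ω) s : ℝ))
          (fun ω s => (CadlagComp.inverse (Y' ω) s : ℝ)) μ μ' ∧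
        ∀ n, ∀ᵐ ω ∂(μ n), Y n ω 0 = 0)) :
    CadlagComp.TendstoL2w (fun n ω => CadlagComp.comp (X n ω) (Y n ω))
      (fun ω => CadlagComp.comp (X' ω) (Y' ω)) μ μ' := by
  -- The alternative `hab` is not used: `(Xₙ, Yₙ) → (X, Y)` f.d.d., the monotonicity of `Yₙ` and the
  -- `𝒞`-tightness of `Xₙ` already determine the limit. For non-decreasing `Yₙ` the modulus attached
  -- to `ℳ₁` vanishes identically.
  obtain ⟨S, hS, hS0, hfdd⟩ := hXY
  have hmod := hXC.1.2
  refine CadlagComp.tendstoL2w_of_tendsto_integral_prod hX hY hX' hY'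
    (CadlagComp.ae_isRegularTime hY' hYinc' hS) (fun k t ht g hg hg' => ?_) fun T c hc => ?_
  · exact CadlagComp.tendsto_integral_prod_compFun hS hX hY hX' hY' hYinc hYinc' hmod hfdd ht hg hg'
  · exact CadlagComp.exists_forall_measure_compFun_gt_le hS hS0 hX hY hX' hY' hYinc hYinc' hmod
      hfdd T hc
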